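/- Let $d\ge 1$, let $\Omega\subset\mathbb R^d$ be closed and convex, let $\rho>0$, and let $\bar\mu$ be a probability measure on $\mathbb R^d$ concentrated on $\Omega$ (i.e. $\bar\mu(\mathbb R^d\setminus\Omega)=0$) with Lebesgue density $\bar u(x)=A\,[(\rho^2-|x|^2)\vee 0]$. Let $R:[0,1]\to[0,1]$ be of class $C^1$ and monotone (nondecreasing or nonincreasing), with $R'(t)\neq 0$ for a.e. $t\in[0,1]$. Put $\mu_t=(T_{R(t)})_\sharp\bar\mu$, where $T_r(x)=rx$, and, where $R(t)>0$, $v_t(x)=x\,R'(t)/R(t)$ and $u_t(x)=R(t)^{-d}\,\bar u(x/R(t))$. Note that $R>0$ on $]0,1[$; $R$ may vanish at one endpoint, where $\mu_t=\delta_0$. Then: 1. $t\mapsto\mu_t$, $t\in[0,1]$, is a Lipschitz curve in the Wasserstein space $W_2(\Omega)$, and $v$ is its tangent field: $v$ is a velocity field, meaning that $v_t\in L^2(\mu_t)$ for a.e. $t$ and $\int\phi\,d\mu_{t_2}-\int\phi\,d\mu_{t_1}=\int_{t_1}^{t_2}\int\nabla\phi\cdot v_s\,d\mu_s\,ds$ for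 all $\phi\in C^1_c(\mathbb R^d)$ and $0\le t_1<t_2\le 1$; and for a.e. $t$ the norm $\|v_t\|_{L^2(\mu_t)}$ is minimal among all velocity fields of the curve. 2. For $t\in\,]0,1[$, $u_t$ is the Lebesgue density of $\mu_t$, and $(u,v)$ is a weak (distributional) solution on $]0,1[\,\times\Omega$ of the system $$\begin{cases}H(t)\nabla u^2+K(t)\,\nabla\cdot(u\,v\otimes v)+\frac{d}{dt}\big(K(t)\,u\,v\big)=0&\text{in }\Omega,\\ \frac{d}{dt}u+\nabla\cdot(v\,u)=0&\text{in }\Omega,\\ u\,v\cdot n=0&\text{on }\partial\Omega,\\ \lim_{t\downarrow0}u_t\mathcal L^d=\mu_0,\quad \lim_{t\uparrow1}u_t\mathcal L^d=\mu_1&\text{(narrow limits),}\end{cases}$$ where $$H(t)=-V(t)^{1/2},\quad K(t)=F(t)\,V(t)^{-1/2},\quad F(t)=\int_\Omega u_t^2\,dx,\quad V(t)=\int_\Omega|v_t|^2u_t\,dx;$$ here, for a.e. $t\in\,]0,1[$, $F(t)$ and $V(t)$ are finite and $V(t)>0$, and the functions $Hu^2$, $Ku\,v_iv_j$, $Ku\,v$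 are locally integrable on $]0,1[\,\times\operatorname{int}\Omega$, while $u$ and $u\,v$ are locally integrable on $]0,1[\,\times\Omega$. The first equation means $$\int_0^1\!\!\int_\Omega H\,u^2\,\nabla\cdot\xi+K\,u\,v\cdot(\nabla\xi\, v+\partial_t\xi)\,dx\,dt=0\qquad\text{for all }\xi\in C_c^\infty(]0,1[\,\times\operatorname{int}\Omega;\mathbb R^d),$$ and the second means $$\int_0^1\!\!\int_\Omega u\,(\partial_t\varphi+v\cdot\nabla\varphi)\,dx\,dt=0\qquad\text{for all }\varphi\in C^\infty_c(]0,1[\,\times\mathbb R^d)$$ (test functions need not vanish on $\partial\Omega$, so this also contains the weak form of the boundary condition). The boundary condition moreover holds pointwise: $u_t(x)\,v_t(x)\cdot n=0$ for all $t\in\,]0,1[$, all $x\in\partial\Omega$ and all $n$ in the normal cone to $\Omega$ at $x$. -/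

import Mathlib

open MeasureTheory Set Filter Topology
open scoped ENNReal NNReal ContDiff

namespace WeightedWasserstein

variable {d : ℕ}

/-- The density profile `x ↦ A [(ρ² - |x|²) ∨ 0]`. -/
noncomputable def parabolicDensity (A ρ : ℝ) (x : EuclideanSpace ℝ (Fin d)) : ℝ :=
  A * max (ρ ^ 2 - ‖x‖ ^ 2) 0

/-! ### Curves in Wasserstein spaces, velocity fields and tangent fields -/

/-- Transport plans between `μ` and `ν`. -/
def couplings (μ ν : Measure (EuclideanSpace ℝ (Fin d))) :
    Set (Measure (EuclideanSpace ℝ (Fin d) × EuclideanSpace ℝ (Fin d))) :=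
  {π | π.map Prod.fst = μ ∧ π.map Prod.snd = ν}

/-- The Wasserstein distance of order `p`. -/
noncomputable def wassersteinDist (p : ℝ) (μ ν : Measure (EuclideanSpace ℝ (Fin d))) : ℝ≥0∞ :=
  (⨅ π ∈ couplings μ ν, ∫⁻ z, edist z.1 z.2 ^ p ∂π) ^ (1 / p)

/-- `μ` belongs to `W_p(Ω)`: a probability measure on `Ω` (seen as a measure on `ℝᵈ` concentrated
on `Ω`) with finite moment of order `p`. -/
structure MemWasserstein (Ω : Set (EuclideanSpace ℝ (Fin d))) (p : ℝ)
    (μ : Measure (EuclideanSpace ℝ (Fin d))) : Prop where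
  prob : IsProbabilityMeasure μ
  concentrated : μ Ωᶜ = 0
  moment : ∫⁻ x, ‖x‖ₑ ^ p ∂μ < ⊤

/-- `t ↦ μ t`, `t ∈ [0,1]`, is a Lipschitz curve with values in `W_p(Ω)`. -/
structure IsLipschitzCurve (Ω : Set (EuclideanSpace ℝ (Fin d))) (p : ℝ)
    (μ : ℝ → Measure (EuclideanSpace ℝ (Fin d))) : Prop where
  mem : ∀ t ∈ Icc (0 : ℝ) 1, MemWasserstein Ω p (μ t)
  lipschitz : ∃ L : ℝ≥0, ∀ s ∈ Icc (0 : ℝ) 1, ∀ t ∈ Icc (0 : ℝ) 1,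
    wassersteinDist p (μ s) (μ t) ≤ L * edist s t

/-- `v` is a velocity field of the curve `μ`: a Borel vector field on `[0,1] × Ω` with
`v_t ∈ L^p(μ_t)` for a.e. `t`, such that `d/dt μ_t + ∇·(v_t μ_t) = 0` in the sense of
distributions. The test functions are the restrictions to the closed set `Ω` of `C¹` functions
with compact support, so no flux through `∂Ω` is allowed. -/
structure IsVelocityField (Ω : Set (EuclideanSpace ℝ (Fin d))) (p : ℝ)
    (μ : ℝ → Measure (EuclideanSpace ℝ (Fin d)))
    (v : ℝ → EuclideanSpace ℝ (Fin d) → EuclideanSpace ℝ (Fin d)) : Prop where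
  measurable : Measurable ((Icc (0 : ℝ) 1 ×ˢ Ω).domRestrict (fun z => v z.1 z.2))
  memLp : ∀ᵐ t ∂(volume.restrict (Icc (0 : ℝ) 1)), MemLp (v t) (ENNReal.ofReal p) (μ t)
  continuity : ∀ φ : EuclideanSpace ℝ (Fin d) → ℝ, ContDiff ℝ 1 φ → HasCompactSupport φ →
    ∀ t₁ ∈ Icc (0 : ℝ) 1, ∀ t₂ ∈ Icc (0 : ℝ) 1, t₁ < t₂ →
      IntervalIntegrable (fun s => ∫ x, fderiv ℝ φ x (v s x) ∂(μ s)) volume t₁ t₂ ∧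
      ∫ x, φ x ∂(μ t₂) - ∫ x, φ x ∂(μ t₁) = ∫ s in t₁..t₂, ∫ x, fderiv ℝ φ x (v s x) ∂(μ s)

/-- `v` is the tangent field of the curve `μ`: a velocity field which for a.e. `t` has minimal
`L^p(μ_t)` norm among all velocity fields. -/
structure IsTangentField (Ω : Set (EuclideanSpace ℝ (Fin d))) (p : ℝ)
    (μ : ℝ → Measure (EuclideanSpace ℝ (Fin d)))
    (v : ℝ → EuclideanSpace ℝ (Fin d) → EuclideanSpace ℝ (Fin d)) : Prop where
  velocity : IsVelocityField Ω p μ v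
  minimal : ∀ w, IsVelocityField Ω p μ w → ∀ᵐ t ∂(volume.restrict (Icc (0 : ℝ) 1)),
    eLpNorm (v t) (ENNReal.ofReal p) (μ t) ≤ eLpNorm (w t) (ENNReal.ofReal p) (μ t)

/-! ### The optimality system -/

/-- `F(t) = ∫_Ω u_t^q dx`. -/
noncomputable def energyF (Ω : Set (EuclideanSpace ℝ (Fin d))) (q : ℝ)
    (u : ℝ → EuclideanSpace ℝ (Fin d) → ℝ) (t : ℝ) : ℝ :=
  ∫ x in Ω, u t x ^ q

/-- `V(t) = ∫_Ω |v_t|^p u_t dx`. -/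
noncomputable def energyV (Ω : Set (EuclideanSpace ℝ (Fin d))) (p : ℝ)
    (u : ℝ → EuclideanSpace ℝ (Fin d) → ℝ)
    (v : ℝ → EuclideanSpace ℝ (Fin d) → EuclideanSpace ℝ (Fin d)) (t : ℝ) : ℝ :=
  ∫ x in Ω, ‖v t x‖ ^ p * u t x

/-- `H(t) = α (1 - q) F(t)^(α-1) V(t)^β`. -/
noncomputable def coeffH (Ω : Set (EuclideanSpace ℝ (Fin d))) (p q α β : ℝ)
    (u : ℝ → EuclideanSpace ℝ (Fin d) → ℝ)
    (v : ℝ → EuclideanSpace ℝ (Fin d) → EuclideanSpace ℝ (Fin d)) (t : ℝ) : ℝ :=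
  α * (1 - q) * energyF Ω q u t ^ (α - 1) * energyV Ω p u v t ^ β

/-- `K(t) = p β F(t)^α V(t)^(β-1)`. -/
noncomputable def coeffK (Ω : Set (EuclideanSpace ℝ (Fin d))) (p q α β : ℝ)
    (u : ℝ → EuclideanSpace ℝ (Fin d) → ℝ)
    (v : ℝ → EuclideanSpace ℝ (Fin d) → EuclideanSpace ℝ (Fin d)) (t : ℝ) : ℝ :=
  p * β * energyF Ω q u t ^ α * energyV Ω p u v t ^ (β - 1)

/-- The spatial divergence of a time-dependent vector field. -/
noncomputable def spaceDiv (ξ : ℝ × EuclideanSpace ℝ (Fin d) → EuclideanSpace ℝ (Fin d))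
    (t : ℝ) (x : EuclideanSpace ℝ (Fin d)) : ℝ :=
  ∑ i, (fderiv ℝ (fun y => ξ (t, y)) x (EuclideanSpace.single i 1)) i

/-- `(u, v)` is a weak (distributional) solution on `]0,1[ × Ω` of the system
* `H(t) ∇u^q + K(t) ∇·(u |v|^(p-2) v ⊗ v) + d/dt (K(t) u |v|^(p-2) v) = 0` in `Ω`,
* `d/dt u + ∇·(v u) = 0` in `Ω`,
* `u v · n = 0` on `∂Ω`,
* `u_t 𝓛ᵈ → μ₀` as `t ↓ 0` and `u_t 𝓛ᵈ → μ₁` as `t ↑ 1` (narrowly),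
with `H`, `K` the functions of time `coeffH`, `coeffK`. -/
structure IsWeakSolution (Ω : Set (EuclideanSpace ℝ (Fin d))) (p q α β : ℝ)
    (μ₀ μ₁ : Measure (EuclideanSpace ℝ (Fin d)))
    (u : ℝ → EuclideanSpace ℝ (Fin d) → ℝ)
    (v : ℝ → EuclideanSpace ℝ (Fin d) → EuclideanSpace ℝ (Fin d)) : Prop where
  /-- `u_t` is a probability density on `Ω`. -/
  nonneg : ∀ t ∈ Ioo (0 : ℝ) 1, ∀ x, 0 ≤ u t x
  mass : ∀ t ∈ Ioo (0 : ℝ) 1, ∫ x in Ω, u t x = 1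
  /-- `F`, `V`, `H`, `K` are well defined for a.e. time. -/
  finite_F : ∀ᵐ t ∂(volume.restrict (Ioo (0 : ℝ) 1)), IntegrableOn (fun x => u t x ^ q) Ω
  finite_V : ∀ᵐ t ∂(volume.restrict (Ioo (0 : ℝ) 1)),
    IntegrableOn (fun x => ‖v t x‖ ^ p * u t x) Ω
  pos_V : β < 1 → ∀ᵐ t ∂(volume.restrict (Ioo (0 : ℝ) 1)), 0 < energyV Ω p u v t
  /-- The terms of the equations are locally integrable, hence define distributions. -/
  locInt_pressure : LocallyIntegrableOn
    (fun z : ℝ × EuclideanSpace ℝ (Fin d) => coeffH Ω p q α β u v z.1 * u z.1 z.2 ^ q)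
    (Ioo (0 : ℝ) 1 ×ˢ interior Ω)
  locInt_tensor : ∀ i j, LocallyIntegrableOn
    (fun z : ℝ × EuclideanSpace ℝ (Fin d) =>
      coeffK Ω p q α β u v z.1 * u z.1 z.2 * ‖v z.1 z.2‖ ^ (p - 2) * (v z.1 z.2 i * v z.1 z.2 j))
    (Ioo (0 : ℝ) 1 ×ˢ interior Ω)
  locInt_momentum : LocallyIntegrableOn
    (fun z : ℝ × EuclideanSpace ℝ (Fin d) =>
      (coeffK Ω p q α β u v z.1 * u z.1 z.2 * ‖v z.1 z.2‖ ^ (p - 2)) • v z.1 z.2)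
    (Ioo (0 : ℝ) 1 ×ˢ interior Ω)
  locInt_density : LocallyIntegrableOn
    (fun z : ℝ × EuclideanSpace ℝ (Fin d) => u z.1 z.2) (Ioo (0 : ℝ) 1 ×ˢ Ω)
  locInt_flux : LocallyIntegrableOn
    (fun z : ℝ × EuclideanSpace ℝ (Fin d) => u z.1 z.2 • v z.1 z.2) (Ioo (0 : ℝ) 1 ×ˢ Ω)
  /-- First equation, tested against `ξ ∈ C_c^∞(]0,1[ × int Ω; ℝᵈ)`. -/
  momentum : ∀ ξ : ℝ × EuclideanSpace ℝ (Fin d) → EuclideanSpace ℝ (Fin d),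
    ContDiff ℝ ∞ ξ → HasCompactSupport ξ → tsupport ξ ⊆ Ioo (0 : ℝ) 1 ×ˢ interior Ω →
    ∫ z in Ioo (0 : ℝ) 1 ×ˢ Ω,
      (coeffH Ω p q α β u v z.1 * u z.1 z.2 ^ q * spaceDiv ξ z.1 z.2
        + coeffK Ω p q α β u v z.1 * u z.1 z.2 * ‖v z.1 z.2‖ ^ (p - 2) *
          (inner ℝ (v z.1 z.2) (fderiv ℝ (fun y => ξ (z.1, y)) z.2 (v z.1 z.2))
            + inner ℝ (v z.1 z.2) (deriv (fun s => ξ (s, z.2)) z.1))) = 0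
  /-- Second equation together with the weak form of `u v · n = 0` on `∂Ω`: the test functions
  need not vanish on `∂Ω`. -/
  continuity : ∀ φ : ℝ × EuclideanSpace ℝ (Fin d) → ℝ,
    ContDiff ℝ ∞ φ → HasCompactSupport φ → tsupport φ ⊆ Ioo (0 : ℝ) 1 ×ˢ univ →
    ∫ z in Ioo (0 : ℝ) 1 ×ˢ Ω,
      u z.1 z.2 * (deriv (fun s => φ (s, z.2)) z.1
        + fderiv ℝ (fun y => φ (z.1, y)) z.2 (v z.1 z.2)) = 0
  /-- Initial and final conditions. -/
  initial : ∀ f : BoundedContinuousFunction (EuclideanSpace ℝ (Fin d)) ℝ,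
    Tendsto (fun t => ∫ x in Ω, f x * u t x) (𝓝[>] 0) (𝓝 (∫ x, f x ∂μ₀))
  final : ∀ f : BoundedContinuousFunction (EuclideanSpace ℝ (Fin d)) ℝ,
    Tendsto (fun t => ∫ x in Ω, f x * u t x) (𝓝[<] 1) (𝓝 (∫ x, f x ∂μ₁))

/-- The boundary condition `u v · n = 0` on `∂Ω` in the classical sense, for every `t ∈ ]0,1[` and
every normal `n` to the convex set `Ω` at a boundary point. -/
def NoFlux (Ω : Set (EuclideanSpace ℝ (Fin d)))
    (u : ℝ → EuclideanSpace ℝ (Fin d) → ℝ)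
    (v : ℝ → EuclideanSpace ℝ (Fin d) → EuclideanSpace ℝ (Fin d)) : Prop :=
  ∀ t ∈ Ioo (0 : ℝ) 1, ∀ x ∈ frontier Ω, ∀ n : EuclideanSpace ℝ (Fin d),
    (∀ y ∈ Ω, inner ℝ n (y - x) ≤ 0) → inner ℝ (u t x • v t x) n = 0

/-- The homothetic curve `μ_t = (T_{R(t)})_♯ μ̄`, where `T_r(x) = r x`. -/
noncomputable def homotheticCurve (R : ℝ → ℝ) (μbar : Measure (EuclideanSpace ℝ (Fin d))) (t : ℝ) :
    Measure (EuclideanSpace ℝ (Fin d)) :=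
  μbar.map (fun x => R t • x)

/-- The density `R(t)^(-d) ū(x / R(t))` of the homothetic curve, `ū` being the density of `μ̄`. -/
noncomputable def homotheticDensity (R : ℝ → ℝ) (ubar : EuclideanSpace ℝ (Fin d) → ℝ) (t : ℝ)
    (x : EuclideanSpace ℝ (Fin d)) : ℝ :=
  (R t ^ d)⁻¹ * ubar ((R t)⁻¹ • x)

/-- The vector field `v_t(x) = x R'(t) / R(t)`, `t ∈ [0,1]`. -/
noncomputable def homotheticField (R : ℝ → ℝ) (t : ℝ) (x : EuclideanSpace ℝ (Fin d)) :
    EuclideanSpace ℝ (Fin d) :=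
  (derivWithin R (Icc (0 : ℝ) 1) t / R t) • x

end WeightedWasserstein

/-!
The field `v_t(x) = x R'(t) / R(t)` is the velocity of the homotheties `s ↦ R(s) y`, and it is a
multiple of `∇(|x|² / 2)`; a velocity field which is a gradient has minimal norm, so `v` is tangent.
The continuity equation, tested against `φ`, is the integral over `y` of
`∫₀¹ d/dt φ(t, R(t) y) dt = 0`.

For the momentum equation, `ū = A (ρ² - |x|²)₊` satisfies `∇ū² = -4 A ū x`, so that `∇u_t²` is a
multiple of `u_t x`. On the other side `V(t)^(1/2) = |R'(t)| m^(1/2)` with `m = ∫ ū |y|²`, hence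
`K v = ± m^(-1/2) (∫ ū²) R^(-d) x / R`, the sign being that of `R'`. This field no longer involves
`R'`, and its derivative along the homotheties is `-d (R' / R) K v`, again a multiple of `x`. The
two multiples cancel because `d ∫ ū² = 4 A m`, which is `∇ū² = -4 A ū x` tested against `x`.
-/

namespace WeightedWasserstein

variable {d : ℕ}

section ParametricIntegral

variable {α : Type*} [MeasurableSpace α] {ν : Measure α} [SFinite ν] {a b : ℝ}
  {g g' : ℝ → α → ℝ}

theorem intervalIntegrable_integral_of_integrable_uncurry (hab : a ≤ b)
    (hint : Integrable (Function.uncurry g') ((volume.restrict (Ioo a b)).prod ν)) :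
    IntervalIntegrable (fun s => ∫ y, g' s y ∂ν) volume a b :=
  (intervalIntegrable_iff_integrableOn_Ioo_of_le hab).2 hint.integral_prod_left

theorem intervalIntegral_integral_eq_integral_sub (hab : a < b)
    (hint : Integrable (Function.uncurry g') ((volume.restrict (Ioo a b)).prod ν))
    (hderiv : ∀ y, ∀ s ∈ Ioo a b, HasDerivAt (fun r => g r y) (g' s y) s) {ga gb : α → ℝ}
    (ha : ∀ y, Tendsto (fun s => g s y) (𝓝[>] a) (𝓝 (ga y)))
    (hb : ∀ y, Tendsto (fun s => g s y) (𝓝[<] b) (𝓝 (gb y))) :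
    ∫ s in a..b, ∫ y, g' s y ∂ν = ∫ y, (gb y - ga y) ∂ν := by
  rw [intervalIntegral.integral_of_le hab.le, integral_Ioc_eq_integral_Ioo,
    integral_integral_swap hint]
  refine integral_congr_ae ?_
  filter_upwards [hint.prod_left_ae] with y hy
  rw [← integral_Ioc_eq_integral_Ioo, ← intervalIntegral.integral_of_le hab.le]
  exact intervalIntegral.integral_eq_sub_of_hasDerivAt_of_tendsto hab (hderiv y)
    ((intervalIntegrable_iff_integrableOn_Ioo_of_le hab.le).2 hy) (ha y) (hb y)

end ParametricIntegral

section WassersteinCurve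

theorem wassersteinDist_map_le {α : Type*} [MeasurableSpace α] {ν : Measure α} {p : ℝ}
    (hp : 0 < p) {f g : α → EuclideanSpace ℝ (Fin d)} (hf : Measurable f) (hg : Measurable g) :
    wassersteinDist p (ν.map f) (ν.map g) ≤ eLpNorm (fun y => f y - g y) (ENNReal.ofReal p) ν := by
  have hfg : Measurable fun y => (f y, g y) := hf.prodMk hg
  have hcoupling : ν.map (fun y => (f y, g y)) ∈ couplings (ν.map f) (ν.map g) :=
    ⟨Measure.map_map measurable_fst hfg, Measure.map_map measurable_snd hfg⟩
  rw [eLpNorm_eq_lintegral_rpow_enorm_toReal (by simpa using hp) ENNReal.ofReal_ne_top,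
    ENNReal.toReal_ofReal hp.le]
  refine ENNReal.rpow_le_rpow ((iInf₂_le _ hcoupling).trans_eq ?_) (by positivity)
  rw [lintegral_map (by fun_prop) hfg]
  simp only [edist_eq_enorm_sub]

theorem memLp_id_homotheticCurve {p : ℝ≥0∞} {R : ℝ → ℝ}
    {ν : Measure (EuclideanSpace ℝ (Fin d))} (hν : MemLp id p ν) (t : ℝ) :
    MemLp id p (homotheticCurve R ν t) :=
  (memLp_map_measure_iff aestronglyMeasurable_id (by fun_prop)).2 (hν.const_smul (R t))

theorem isProbabilityMeasure_homotheticCurve {R : ℝ → ℝ}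
    {ν : Measure (EuclideanSpace ℝ (Fin d))} [IsProbabilityMeasure ν] (t : ℝ) :
    IsProbabilityMeasure (homotheticCurve R ν t) :=
  Measure.isProbabilityMeasure_map (by fun_prop)

theorem homotheticCurve_compl_eq_zero_of_starConvex {Ω : Set (EuclideanSpace ℝ (Fin d))}
    (hΩ : MeasurableSet Ω) (hstar : StarConvex ℝ 0 Ω) {ν : Measure (EuclideanSpace ℝ (Fin d))}
    (hν : ν Ωᶜ = 0) {R : ℝ → ℝ} {t : ℝ} (ht : R t ∈ Icc (0 : ℝ) 1) :
    homotheticCurve R ν t Ωᶜ = 0 := by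
  rw [homotheticCurve, Measure.map_apply (by fun_prop) hΩ.compl]
  exact measure_mono_null (fun x hx hxΩ => hx (hstar.smul_mem hxΩ ht.1 ht.2)) hν

theorem isLipschitzCurve_homotheticCurve {Ω : Set (EuclideanSpace ℝ (Fin d))} {p : ℝ} (hp : 1 ≤ p)
    {R : ℝ → ℝ} {L : ℝ≥0} (hR : LipschitzOnWith L R (Icc 0 1))
    {ν : Measure (EuclideanSpace ℝ (Fin d))} [IsProbabilityMeasure ν]
    (hν : MemLp id (ENNReal.ofReal p) ν)
    (hΩ : ∀ t ∈ Icc (0 : ℝ) 1, homotheticCurve R ν t Ωᶜ = 0) :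
    IsLipschitzCurve Ω p (homotheticCurve R ν) where
  mem t ht :=
    { prob := isProbabilityMeasure_homotheticCurve t
      concentrated := hΩ t ht
      moment := by
        have hp₀ : 0 < p := zero_lt_one.trans_le hp
        simpa [ENNReal.toReal_ofReal hp₀.le] using
          (eLpNorm_lt_top_iff_lintegral_rpow_enorm_lt_top (by simpa using hp₀)
            ENNReal.ofReal_ne_top).1 (memLp_id_homotheticCurve hν t).2 }
  lipschitz := by
    have hM : eLpNorm id (ENNReal.ofReal p) ν ≠ ⊤ := hν.2.ne
    refine ⟨L * (eLpNorm id (ENNReal.ofReal p) ν).toNNReal, fun s hs t ht => ?_⟩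
    calc wassersteinDist p (homotheticCurve R ν s) (homotheticCurve R ν t)
        ≤ eLpNorm (fun y => R s • y - R t • y) (ENNReal.ofReal p) ν :=
          wassersteinDist_map_le (by positivity) (by fun_prop) (by fun_prop)
      _ = edist (R s) (R t) * eLpNorm id (ENNReal.ofReal p) ν := by
          simp only [← sub_smul, edist_eq_enorm_sub]
          exact eLpNorm_const_smul (R s - R t) id _ ν
      _ ≤ L * edist s t * eLpNorm id (ENNReal.ofReal p) ν := by
          gcongr
          exact hR hs ht
      _ = _ := by
          rw [ENNReal.coe_mul, ENNReal.coe_toNNReal hM, mul_right_comm]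

end WassersteinCurve

section VelocityField

variable {R : ℝ → ℝ} {t : ℝ}

theorem hasDerivAt_derivWithin_Icc (hR : ContDiffOn ℝ 1 R (Icc 0 1)) (ht : t ∈ Ioo (0 : ℝ) 1) :
    HasDerivAt R (derivWithin R (Icc 0 1) t) t :=
  (hR.differentiableOn one_ne_zero t (Ioo_subset_Icc_self ht)).hasDerivWithinAt.hasDerivAt
    (Icc_mem_nhds ht.1 ht.2)

theorem continuousOn_derivWithin_Icc (hR : ContDiffOn ℝ 1 R (Icc 0 1)) :
    ContinuousOn (derivWithin R (Icc 0 1)) (Icc 0 1) :=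
  hR.continuousOn_derivWithin (uniqueDiffOn_Icc one_pos) le_rfl

theorem homotheticField_smul (ht : R t ≠ 0) (y : EuclideanSpace ℝ (Fin d)) :
    homotheticField R t (R t • y) = derivWithin R (Icc 0 1) t • y := by
  rw [homotheticField, smul_smul, div_mul_cancel₀ _ ht]

theorem continuous_homotheticField (t : ℝ) :
    Continuous (homotheticField R t : EuclideanSpace ℝ (Fin d) → EuclideanSpace ℝ (Fin d)) :=
  continuous_const_smul _

theorem hasDerivAt_smul_homotheticField (hR : ContDiffOn ℝ 1 R (Icc 0 1))
    (ht : t ∈ Ioo (0 : ℝ) 1) (hRt : R t ≠ 0) (y : EuclideanSpace ℝ (Fin d)) :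
    HasDerivAt (fun s => R s • y) (homotheticField R t (R t • y)) t := by
  rw [homotheticField_smul hRt]
  exact (hasDerivAt_derivWithin_Icc hR ht).smul_const y

theorem measurable_domRestrict_homotheticField (hR : ContDiffOn ℝ 1 R (Icc 0 1))
    (Ω : Set (EuclideanSpace ℝ (Fin d))) :
    Measurable ((Icc (0 : ℝ) 1 ×ˢ Ω).domRestrict (fun z => homotheticField R z.1 z.2)) := by
  have hderiv : Continuous fun z : ↥(Icc (0 : ℝ) 1 ×ˢ Ω) => derivWithin R (Icc 0 1) z.1.1 :=
    (continuousOn_derivWithin_Icc hR).comp_continuous (by fun_prop) fun z => z.2.1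
  have hscale : Continuous fun z : ↥(Icc (0 : ℝ) 1 ×ˢ Ω) => R z.1.1 :=
    hR.continuousOn.comp_continuous (by fun_prop) fun z => z.2.1
  have hpoint : Measurable fun z : ↥(Icc (0 : ℝ) 1 ×ˢ Ω) => z.1.2 := by fun_prop
  exact (hderiv.measurable.div hscale.measurable).smul hpoint

theorem integral_homotheticCurve {F : Type*} [NormedAddCommGroup F] [NormedSpace ℝ F]
    (ν : Measure (EuclideanSpace ℝ (Fin d))) {f : EuclideanSpace ℝ (Fin d) → F}
    (hf : Continuous f) : ∫ x, f x ∂(homotheticCurve R ν t) = ∫ y, f (R t • y) ∂ν :=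
  integral_map (by fun_prop) hf.aestronglyMeasurable

theorem integral_fderiv_homotheticField (ν : Measure (EuclideanSpace ℝ (Fin d)))
    {φ : EuclideanSpace ℝ (Fin d) → ℝ} (hφ : ContDiff ℝ 1 φ) (ht : R t ≠ 0) :
    ∫ x, fderiv ℝ φ x (homotheticField R t x) ∂(homotheticCurve R ν t) =
      ∫ y, fderiv ℝ φ (R t • y) (derivWithin R (Icc 0 1) t • y) ∂ν := by
  rw [integral_homotheticCurve ν
    ((hφ.continuous_fderiv one_ne_zero).clm_apply (continuous_homotheticField t))]
  simp only [homotheticField_smul ht]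

theorem integrable_fderiv_smul_derivWithin (hR : ContDiffOn ℝ 1 R (Icc 0 1))
    {ν : Measure (EuclideanSpace ℝ (Fin d))} [SFinite ν] (hν : Integrable id ν)
    {φ : EuclideanSpace ℝ (Fin d) → ℝ} (hφ : ContDiff ℝ 1 φ) (hφc : HasCompactSupport φ) :
    Integrable
      (Function.uncurry fun s y => fderiv ℝ φ (R s • y) (derivWithin R (Icc 0 1) s • y))
      ((volume.restrict (Icc 0 1)).prod ν) := by
  have hφ' : Continuous (fderiv ℝ φ) := hφ.continuous_fderiv one_ne_zero
  obtain ⟨C, hC⟩ := hφ'.bounded_above_of_compact_support (hφc.fderiv (𝕜 := ℝ))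
  obtain ⟨L, hL⟩ := isCompact_Icc.exists_bound_of_continuousOn (continuousOn_derivWithin_Icc hR)
  have hprod : (volume.restrict (Icc 0 1)).prod ν
      = (volume.prod ν).restrict (Icc (0 : ℝ) 1 ×ˢ univ) := by
    rw [← Measure.prod_restrict, Measure.restrict_univ]
  have hcont : ContinuousOn
      (Function.uncurry fun s y => fderiv ℝ φ (R s • y) (derivWithin R (Icc 0 1) s • y))
      (Icc 0 1 ×ˢ univ) := by
    have hfst : MapsTo Prod.fst (Icc (0 : ℝ) 1 ×ˢ (univ : Set (EuclideanSpace ℝ (Fin d))))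
        (Icc 0 1) := fun z hz => hz.1
    exact (hφ'.comp_continuousOn
      ((hR.continuousOn.comp continuousOn_fst hfst).smul continuousOn_snd)).clm_apply
      (((continuousOn_derivWithin_Icc hR).comp continuousOn_fst hfst).smul continuousOn_snd)
  refine (((hν.norm.const_mul (C * L)).comp_snd (volume.restrict (Icc 0 1))).mono' ?_ ?_)
  · rw [hprod]
    exact hcont.aestronglyMeasurable (measurableSet_Icc.prod MeasurableSet.univ)
  · rw [hprod]
    filter_upwards [ae_restrict_mem (measurableSet_Icc.prod MeasurableSet.univ)] with z hz
    calc ‖fderiv ℝ φ (R z.1 • z.2) (derivWithin R (Icc 0 1) z.1 • z.2)‖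
        ≤ ‖fderiv ℝ φ (R z.1 • z.2)‖ * ‖derivWithin R (Icc 0 1) z.1 • z.2‖ :=
          ContinuousLinearMap.le_opNorm _ _
      _ ≤ C * (L * ‖z.2‖) := by
          rw [norm_smul]
          gcongr
          exacts [(norm_nonneg _).trans (hC 0), hC _, hL _ hz.1]
      _ = C * L * ‖z.2‖ := by rw [mul_assoc]

theorem intervalIntegral_integral_fderiv_smul_eq_sub (hR : ContDiffOn ℝ 1 R (Icc 0 1))
    {ν : Measure (EuclideanSpace ℝ (Fin d))} [IsFiniteMeasure ν] (hν : Integrable id ν)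
    {φ : EuclideanSpace ℝ (Fin d) → ℝ} (hφ : ContDiff ℝ 1 φ) (hφc : HasCompactSupport φ)
    {t₁ t₂ : ℝ} (ht₁ : 0 ≤ t₁) (h₁₂ : t₁ < t₂) (ht₂ : t₂ ≤ 1) :
    ∫ s in t₁..t₂, ∫ y, fderiv ℝ φ (R s • y) (derivWithin R (Icc 0 1) s • y) ∂ν =
      ∫ x, φ x ∂(homotheticCurve R ν t₂) - ∫ x, φ x ∂(homotheticCurve R ν t₁) := by
  have hIoo : Ioo t₁ t₂ ⊆ Ioo 0 1 := Ioo_subset_Ioo ht₁ ht₂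
  have hint := (integrable_fderiv_smul_derivWithin hR hν hφ hφc).mono_measure
    (Measure.prod_mono (Measure.restrict_mono (hIoo.trans Ioo_subset_Icc_self) le_rfl) le_rfl)
  have hcont (y : EuclideanSpace ℝ (Fin d)) : ContinuousOn (fun s => φ (R s • y)) (Icc 0 1) :=
    hφ.continuous.comp_continuousOn (hR.continuousOn.smul continuousOn_const)
  have hφint (t : ℝ) : Integrable (fun y => φ (R t • y)) ν :=
    (hφ.continuous.integrable_of_hasCompactSupport hφc
      (μ := ν.map fun y => R t • y)).comp_measurable (by fun_prop)
  rw [integral_homotheticCurve ν hφ.continuous, integral_homotheticCurve ν hφ.continuous,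
    ← integral_sub (hφint t₂) (hφint t₁)]
  exact intervalIntegral_integral_eq_integral_sub h₁₂ hint
    (fun y s hs => (hφ.differentiable one_ne_zero _).hasFDerivAt.comp_hasDerivAt s
      ((hasDerivAt_derivWithin_Icc hR (hIoo hs)).smul_const y))
    (fun y => (hcont y t₁ ⟨ht₁, h₁₂.le.trans ht₂⟩).tendsto.mono_left
      (nhdsWithin_le_iff.2 (Icc_mem_nhdsGT_of_mem ⟨ht₁, h₁₂.trans_le ht₂⟩)))
    (fun y => (hcont y t₂ ⟨ht₁.trans h₁₂.le, ht₂⟩).tendsto.mono_left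
      (nhdsWithin_le_iff.2 (Icc_mem_nhdsLT_of_mem ⟨ht₁.trans_lt h₁₂, ht₂⟩)))

theorem isVelocityField_homotheticField {p : ℝ} (hp : 1 ≤ p)
    (Ω : Set (EuclideanSpace ℝ (Fin d))) {ν : Measure (EuclideanSpace ℝ (Fin d))}
    [IsFiniteMeasure ν] (hν : MemLp id (ENNReal.ofReal p) ν) (hR : ContDiffOn ℝ 1 R (Icc 0 1))
    (hR₀ : ∀ t ∈ Ioo (0 : ℝ) 1, R t ≠ 0) :
    IsVelocityField Ω p (homotheticCurve R ν) (homotheticField R) where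
  measurable := measurable_domRestrict_homotheticField hR Ω
  memLp := ae_of_all _ fun t => (memLp_id_homotheticCurve hν t).const_smul
    (derivWithin R (Icc 0 1) t / R t)
  continuity φ hφ hφc t₁ ht₁ t₂ ht₂ h₁₂ := by
    have hν₁ : Integrable id ν := hν.integrable (by simpa using hp)
    have hIoo : Ioo t₁ t₂ ⊆ Ioo 0 1 := Ioo_subset_Ioo ht₁.1 ht₂.2
    have hint := (integrable_fderiv_smul_derivWithin hR hν₁ hφ hφc).mono_measure
      (Measure.prod_mono (Measure.restrict_mono (hIoo.trans Ioo_subset_Icc_self) le_rfl) le_rfl)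
    have heq : ∀ᵐ s ∂(volume.restrict (uIoc t₁ t₂)),
        ∫ y, fderiv ℝ φ (R s • y) (derivWithin R (Icc 0 1) s • y) ∂ν =
          ∫ x, fderiv ℝ φ x (homotheticField R s x) ∂(homotheticCurve R ν s) := by
      rw [uIoc_of_le h₁₂.le, ← restrict_Ioo_eq_restrict_Ioc]
      filter_upwards [ae_restrict_mem measurableSet_Ioo] with s hs
      exact (integral_fderiv_homotheticField ν hφ (hR₀ s (hIoo hs))).symm
    refine ⟨(intervalIntegrable_integral_of_integrable_uncurry h₁₂.le hint).congr_ae heq, ?_⟩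
    rw [← intervalIntegral.integral_congr_ae_restrict heq,
      intervalIntegral_integral_fderiv_smul_eq_sub hR hν₁ hφ hφc ht₁.1 h₁₂ ht₂.2]

end VelocityField

section TangentField

theorem ae_eq_of_forall_intervalIntegral_eq {f g : ℝ → ℝ}
    (hf : IntervalIntegrable f volume 0 1) (hg : IntervalIntegrable g volume 0 1)
    (h : ∀ t ∈ Ioo (0 : ℝ) 1, ∫ s in (0 : ℝ)..t, f s = ∫ s in (0 : ℝ)..t, g s) :
    f =ᵐ[volume.restrict (Icc 0 1)] g := by
  rw [← restrict_Ioo_eq_restrict_Icc]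
  filter_upwards [ae_restrict_of_ae hf.ae_hasDerivAt_integral,
    ae_restrict_of_ae hg.ae_hasDerivAt_integral, ae_restrict_mem measurableSet_Ioo]
    with t hft hgt ht
  have htI : t ∈ uIcc (0 : ℝ) 1 := Icc_subset_uIcc (Ioo_subset_Icc_self ht)
  refine (hft htI 0 left_mem_uIcc).unique
    ((hgt htI 0 left_mem_uIcc).congr_of_eventuallyEq ?_)
  filter_upwards [Ioo_mem_nhds ht.1 ht.2] with s hs using h s hs

theorem eLpNorm_two_le_of_integral_inner_eq {α F : Type*} [MeasurableSpace α] {μ : Measure α}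
    [NormedAddCommGroup F] [InnerProductSpace ℝ F] {f g : α → F} (hf : MemLp f 2 μ)
    (hg : MemLp g 2 μ) (h : ∫ x, inner ℝ (f x) (g x) ∂μ = ∫ x, inner ℝ (f x) (f x) ∂μ) :
    eLpNorm f 2 μ ≤ eLpNorm g 2 μ := by
  have hinner : inner ℝ (hf.toLp f) (hg.toLp g) = ‖hf.toLp f‖ * ‖hf.toLp f‖ := by
    rw [← real_inner_self_eq_norm_mul_norm, L2.inner_def, L2.inner_def,
      integral_congr_ae (EventuallyEq.comp₂ hf.coeFn_toLp (inner ℝ) hg.coeFn_toLp),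
      integral_congr_ae (EventuallyEq.comp₂ hf.coeFn_toLp (inner ℝ) hf.coeFn_toLp), h]
  have hnorm : ‖hf.toLp f‖ ≤ ‖hg.toLp g‖ := by
    by_contra! hlt
    have hcs := real_inner_le_norm (hf.toLp f) (hg.toLp g)
    rw [hinner] at hcs
    exact hcs.not_gt (by gcongr; exact (norm_nonneg _).trans_lt hlt)
  rwa [Lp.norm_toLp, Lp.norm_toLp,
    ENNReal.toReal_le_toReal hf.eLpNorm_ne_top hg.eLpNorm_ne_top] at hnorm

variable {Ω : Set (EuclideanSpace ℝ (Fin d))} {μ : ℝ → Measure (EuclideanSpace ℝ (Fin d))}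
  {v w : ℝ → EuclideanSpace ℝ (Fin d) → EuclideanSpace ℝ (Fin d)}
  {φ : EuclideanSpace ℝ (Fin d) → ℝ}

theorem IsVelocityField.ae_integral_fderiv_eq {p : ℝ} (hv : IsVelocityField Ω p μ v)
    (hw : IsVelocityField Ω p μ w) (hφ : ContDiff ℝ 1 φ) (hφc : HasCompactSupport φ) :
    ∀ᵐ t ∂(volume.restrict (Icc (0 : ℝ) 1)),
      ∫ x, fderiv ℝ φ x (v t x) ∂(μ t) = ∫ x, fderiv ℝ φ x (w t x) ∂(μ t) := by
  have h₀ : (0 : ℝ) ∈ Icc (0 : ℝ) 1 := left_mem_Icc.2 zero_le_one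
  have h₁ : (1 : ℝ) ∈ Icc (0 : ℝ) 1 := right_mem_Icc.2 zero_le_one
  refine ae_eq_of_forall_intervalIntegral_eq (hv.continuity φ hφ hφc 0 h₀ 1 h₁ one_pos).1
    (hw.continuity φ hφ hφc 0 h₀ 1 h₁ one_pos).1 fun t ht => ?_
  rw [← (hv.continuity φ hφ hφc 0 h₀ t (Ioo_subset_Icc_self ht) ht.1).2,
    ← (hw.continuity φ hφ hφc 0 h₀ t (Ioo_subset_Icc_self ht) ht.1).2]

/-- The continuity equation fixes `∫ ⟨∇φ, w_t⟩ dμ_t` for every velocity field `w`, so a velocity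
field proportional to `∇φ` is orthogonal to every `w - v`. -/
theorem IsVelocityField.isTangentField_of_inner_eq (hv : IsVelocityField Ω 2 μ v)
    (hφ : ContDiff ℝ 1 φ) (hφc : HasCompactSupport φ) (c : ℝ → ℝ)
    (hgrad : ∀ᵐ t ∂(volume.restrict (Icc (0 : ℝ) 1)), ∀ᵐ x ∂(μ t), ∀ y,
      inner ℝ (v t x) y = c t * fderiv ℝ φ x y) :
    IsTangentField Ω 2 μ v where
  velocity := hv
  minimal w hw := by
    filter_upwards [hv.memLp, hw.memLp, hgrad, hv.ae_integral_fderiv_eq hw hφ hφc]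
      with t hvt hwt hgradt heq
    rw [ENNReal.ofReal_ofNat] at hvt hwt ⊢
    refine eLpNorm_two_le_of_integral_inner_eq hvt hwt ?_
    calc ∫ x, inner ℝ (v t x) (w t x) ∂(μ t)
        = c t * ∫ x, fderiv ℝ φ x (w t x) ∂(μ t) := by
          rw [← integral_const_mul]
          exact integral_congr_ae (hgradt.mono fun x hx => hx _)
      _ = c t * ∫ x, fderiv ℝ φ x (v t x) ∂(μ t) := by rw [heq]
      _ = ∫ x, inner ℝ (v t x) (v t x) ∂(μ t) := by
          rw [← integral_const_mul]
          exact integral_congr_ae (hgradt.mono fun x hx => (hx _).symm)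

theorem exists_hasCompactSupport_fderiv_eq_innerSL {F : Type*} [NormedAddCommGroup F]
    [InnerProductSpace ℝ F] [FiniteDimensional ℝ F] (r : ℝ) :
    ∃ φ : F → ℝ, ContDiff ℝ 1 φ ∧ HasCompactSupport φ ∧
      ∀ x, ‖x‖ ≤ r → fderiv ℝ φ x = innerSL ℝ x := by
  let χ : ContDiffBump (0 : F) := ⟨|r| + 1, |r| + 2, by positivity, by linarith⟩
  refine ⟨fun x => χ x * (2⁻¹ * ‖x‖ ^ 2), χ.contDiff.mul (contDiff_const.mul
    (contDiff_norm_sq ℝ)), χ.hasCompactSupport.mul_right, fun x hx => ?_⟩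
  have hball : x ∈ Metric.ball (0 : F) (|r| + 1) := by
    rw [mem_ball_zero_iff]
    linarith [le_abs_self r]
  have hχ : (fun y => χ y * (2⁻¹ * ‖y‖ ^ 2)) =ᶠ[𝓝 x] fun y => 2⁻¹ * ‖y‖ ^ 2 := by
    filter_upwards [Metric.isOpen_ball.mem_nhds hball] with y hy
    rw [χ.one_of_mem_closedBall (Metric.ball_subset_closedBall hy), one_mul]
  rw [hχ.fderiv_eq, ((hasStrictFDerivAt_norm_sq x).hasFDerivAt.const_mul _).fderiv]
  ext y
  simp

theorem ae_norm_homotheticCurve_le {R : ℝ → ℝ} {ν : Measure (EuclideanSpace ℝ (Fin d))} {ρ : ℝ}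
    (hν : ∀ᵐ y ∂ν, ‖y‖ ≤ ρ) (t : ℝ) : ∀ᵐ x ∂(homotheticCurve R ν t), ‖x‖ ≤ |R t| * ρ := by
  refine (ae_map_iff (by fun_prop) (measurableSet_le (by fun_prop) (by fun_prop))).2 ?_
  filter_upwards [hν] with y hy
  rw [norm_smul, Real.norm_eq_abs]
  gcongr

theorem isTangentField_homotheticField (Ω : Set (EuclideanSpace ℝ (Fin d)))
    {ν : Measure (EuclideanSpace ℝ (Fin d))} [IsFiniteMeasure ν] {ρ : ℝ} (hρ : 0 ≤ ρ)
    (hν : ∀ᵐ y ∂ν, ‖y‖ ≤ ρ) {R : ℝ → ℝ} (hR : ContDiffOn ℝ 1 R (Icc 0 1))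
    (hR₀ : ∀ t ∈ Ioo (0 : ℝ) 1, R t ≠ 0) :
    IsTangentField Ω 2 (homotheticCurve R ν) (homotheticField R) := by
  obtain ⟨C, hC⟩ := isCompact_Icc.exists_bound_of_continuousOn hR.continuousOn
  obtain ⟨φ, hφ, hφc, hφ'⟩ := exists_hasCompactSupport_fderiv_eq_innerSL
    (F := EuclideanSpace ℝ (Fin d)) (C * ρ)
  have hmem : MemLp id (ENNReal.ofReal 2) ν := MemLp.of_bound aestronglyMeasurable_id ρ hν
  refine (isVelocityField_homotheticField one_le_two Ω hmem hR hR₀).isTangentField_of_inner_eq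
    hφ hφc (fun t => derivWithin R (Icc 0 1) t / R t) ?_
  filter_upwards [ae_restrict_mem measurableSet_Icc] with t ht
  filter_upwards [ae_norm_homotheticCurve_le hν t] with x hx y
  rw [hφ' x (hx.trans (mul_le_mul_of_nonneg_right (hC t ht) hρ)), homotheticField,
    real_inner_smul_left, innerSL_apply_apply]

end TangentField

section ScalingFactor

theorem strictMonoOn_of_ae_derivWithin_ne_zero {f : ℝ → ℝ} {a b : ℝ}
    (hf : MonotoneOn f (Icc a b))
    (hderiv : ∀ᵐ t ∂(volume.restrict (Icc a b)), derivWithin f (Icc a b) t ≠ 0) :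
    StrictMonoOn f (Icc a b) := by
  intro x hx y hy hxy
  refine (hf hx hy hxy.le).lt_of_ne fun heq => ?_
  have hconst : ∀ t ∈ Ioo x y, f t = f x := fun t ht =>
    have htI : t ∈ Icc a b := ⟨hx.1.trans ht.1.le, ht.2.le.trans hy.2⟩
    ((hf htI hy ht.2.le).trans_eq heq.symm).antisymm (hf hx htI ht.1.le)
  have hzero : ∀ t ∈ Ioo x y, derivWithin f (Icc a b) t = 0 := fun t ht => by
    have hev : f =ᶠ[𝓝 t] fun _ => f x :=
      eventually_of_mem (Ioo_mem_nhds ht.1 ht.2) hconst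
    rw [(hev.filter_mono nhdsWithin_le_nhds).derivWithin_eq hev.eq_of_nhds, derivWithin_fun_const,
      Pi.zero_apply]
  have hnull : volume (Ioo x y) = 0 := by
    refine measure_mono_null (fun t ht => ?_)
      (ae_iff.1 ((ae_restrict_iff' measurableSet_Icc).1 hderiv))
    exact fun h => h ⟨hx.1.trans ht.1.le, ht.2.le.trans hy.2⟩ (hzero t ht)
  exact hxy.not_ge (by simpa using hnull)

theorem strictAntiOn_of_ae_derivWithin_ne_zero {f : ℝ → ℝ} {a b : ℝ}
    (hf : AntitoneOn f (Icc a b))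
    (hderiv : ∀ᵐ t ∂(volume.restrict (Icc a b)), derivWithin f (Icc a b) t ≠ 0) :
    StrictAntiOn f (Icc a b) := by
  have hneg : StrictMonoOn (fun t => -f t) (Icc a b) :=
    strictMonoOn_of_ae_derivWithin_ne_zero hf.neg (hderiv.mono fun t ht => by
      rwa [derivWithin.fun_neg, neg_ne_zero])
  exact fun x hx y hy hxy => neg_lt_neg_iff.1 (hneg hx hy hxy)

variable {R : ℝ → ℝ}

theorem pos_of_monotoneOn_or_antitoneOn (hmaps : MapsTo R (Icc 0 1) (Ici 0))
    (hmono : MonotoneOn R (Icc 0 1) ∨ AntitoneOn R (Icc 0 1))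
    (hderiv : ∀ᵐ t ∂(volume.restrict (Icc (0 : ℝ) 1)), derivWithin R (Icc 0 1) t ≠ 0)
    {t : ℝ} (ht : t ∈ Ioo (0 : ℝ) 1) : 0 < R t := by
  have h₀ : (0 : ℝ) ∈ Icc (0 : ℝ) 1 := left_mem_Icc.2 zero_le_one
  have h₁ : (1 : ℝ) ∈ Icc (0 : ℝ) 1 := right_mem_Icc.2 zero_le_one
  have htI := Ioo_subset_Icc_self ht
  rcases hmono with hmono | hanti
  · exact (hmaps h₀).trans_lt (strictMonoOn_of_ae_derivWithin_ne_zero hmono hderiv h₀ htI ht.1)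
  · exact (hmaps h₁).trans_lt (strictAntiOn_of_ae_derivWithin_ne_zero hanti hderiv htI h₁ ht.2)

theorem exists_ae_sign_derivWithin_eq
    (hmono : MonotoneOn R (Icc 0 1) ∨ AntitoneOn R (Icc 0 1))
    (hderiv : ∀ᵐ t ∂(volume.restrict (Icc (0 : ℝ) 1)), derivWithin R (Icc 0 1) t ≠ 0) :
    ∃ σ : SignType, ∀ᵐ t ∂(volume.restrict (Icc (0 : ℝ) 1)),
      SignType.sign (derivWithin R (Icc 0 1) t) = σ := by
  rcases hmono with hmono | hanti
  · exact ⟨1, hderiv.mono fun t ht => sign_pos (hmono.derivWithin_nonneg.lt_of_ne' ht)⟩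
  · exact ⟨-1, hderiv.mono fun t ht => sign_neg (hanti.derivWithin_nonpos.lt_of_ne ht)⟩

end ScalingFactor

section HomotheticDensity

theorem integral_withDensity_ofReal {α : Type*} [MeasurableSpace α] {μ : Measure α} {u : α → ℝ}
    (hu : Measurable u) (hu₀ : 0 ≤ u) (f : α → ℝ) :
    ∫ x, f x ∂(μ.withDensity fun x => ENNReal.ofReal (u x)) = ∫ x, u x * f x ∂μ := by
  rw [integral_withDensity_eq_integral_toReal_smul hu.ennreal_ofReal (by simp)]
  simp only [ENNReal.toReal_ofReal (hu₀ _), smul_eq_mul]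

theorem support_subset_of_withDensity_compl_eq_zero {X : Type*} [TopologicalSpace X]
    [MeasurableSpace X] [OpensMeasurableSpace X] {μ : Measure X} [μ.IsOpenPosMeasure] {u : X → ℝ}
    (hu : Continuous u) (hu₀ : 0 ≤ u) {Ω : Set X} (hΩ : IsClosed Ω)
    (h : μ.withDensity (fun x => ENNReal.ofReal (u x)) Ωᶜ = 0) : Function.support u ⊆ Ω := by
  rw [withDensity_apply_eq_zero hu.measurable.ennreal_ofReal] at h
  have hempty : Function.support u ∩ Ωᶜ = ∅ := by
    refine (hu.isOpen_support.inter hΩ.isOpen_compl).eq_empty_of_measure_zero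
      (measure_mono_null ?_ h)
    exact inter_subset_inter_left _ fun x hx =>
      (ENNReal.ofReal_pos.2 ((hu₀ x).lt_of_ne' hx)).ne'
  rwa [← sdiff_eq, sdiff_eq_empty] at hempty

variable {R : ℝ → ℝ} {t : ℝ} {u : EuclideanSpace ℝ (Fin d) → ℝ}
  {Ω : Set (EuclideanSpace ℝ (Fin d))}

theorem continuous_homotheticDensity (hu : Continuous u) (t : ℝ) :
    Continuous (homotheticDensity R u t) :=
  continuous_const.mul (hu.comp (continuous_const_smul _))

theorem homotheticDensity_nonneg (hu₀ : 0 ≤ u) (ht : 0 ≤ R t) : 0 ≤ homotheticDensity R u t :=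
  fun _ => mul_nonneg (by positivity) (hu₀ _)

theorem homotheticDensity_smul (ht : R t ≠ 0) (y : EuclideanSpace ℝ (Fin d)) :
    homotheticDensity R u t (R t • y) = (R t ^ d)⁻¹ * u y := by
  rw [homotheticDensity, smul_smul, inv_mul_cancel₀ ht, one_smul]

theorem homotheticCurve_withDensity (hu : Measurable u) (ht : 0 < R t) :
    homotheticCurve R (volume.withDensity fun x => ENNReal.ofReal (u x)) t
      = volume.withDensity (fun x => ENNReal.ofReal (homotheticDensity R u t x)) := by
  have hm : Measurable fun x : EuclideanSpace ℝ (Fin d) => R t • x := by fun_prop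
  have hu' : Measurable fun x : EuclideanSpace ℝ (Fin d) => ENNReal.ofReal (u ((R t)⁻¹ • x)) :=
    (hu.comp (measurable_const_smul _)).ennreal_ofReal
  have hpos : 0 < (R t ^ d)⁻¹ := by positivity
  ext s hs
  have hpull : ∫⁻ x in (fun x : EuclideanSpace ℝ (Fin d) => R t • x) ⁻¹' s, ENNReal.ofReal (u x)
      = ∫⁻ x in s, ENNReal.ofReal (u ((R t)⁻¹ • x))
          ∂(volume.map fun x : EuclideanSpace ℝ (Fin d) => R t • x) := by
    rw [setLIntegral_map hs hu' hm]
    simp only [smul_smul, inv_mul_cancel₀ ht.ne', one_smul]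
  rw [homotheticCurve, Measure.map_apply hm hs, withDensity_apply _ (hm hs),
    withDensity_apply _ hs, hpull, Measure.map_addHaar_smul _ ht.ne', Measure.restrict_smul,
    lintegral_smul_measure, finrank_euclideanSpace_fin, abs_of_pos hpos, smul_eq_mul,
    ← lintegral_const_mul _ hu']
  simp only [homotheticDensity, ENNReal.ofReal_mul hpos.le]

theorem support_homotheticDensity_subset (hu : Continuous u) (hu₀ : 0 ≤ u) (hΩ : IsClosed Ω)
    (ht : 0 < R t)
    (h : homotheticCurve R (volume.withDensity fun x => ENNReal.ofReal (u x)) t Ωᶜ = 0) :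
    Function.support (homotheticDensity R u t) ⊆ Ω :=
  support_subset_of_withDensity_compl_eq_zero (continuous_homotheticDensity hu t)
    (homotheticDensity_nonneg hu₀ ht.le) hΩ (homotheticCurve_withDensity hu.measurable ht ▸ h)

theorem setIntegral_homotheticDensity_mul (hΩ : Function.support (homotheticDensity R u t) ⊆ Ω)
    (ht : 0 < R t) (f : EuclideanSpace ℝ (Fin d) → ℝ) :
    ∫ x in Ω, homotheticDensity R u t x * f x = ∫ y, u y * f (R t • y) := by
  have hcomp := Measure.integral_comp_smul volume (fun x => u ((R t)⁻¹ • x) * f x) (R t)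
  have hpos : 0 < (R t ^ d)⁻¹ := by positivity
  simp only [smul_smul, inv_mul_cancel₀ ht.ne', one_smul, finrank_euclideanSpace_fin,
    abs_of_pos hpos, smul_eq_mul] at hcomp
  rw [setIntegral_eq_integral_of_forall_compl_eq_zero, hcomp, ← integral_const_mul]
  · simp only [homotheticDensity, mul_assoc]
  · intro x hx
    rw [Function.notMem_support.1 fun h => hx (hΩ h), zero_mul]

theorem setIntegral_mul_homotheticDensity_eq_integral_homotheticCurve (hu : Measurable u)
    (hu₀ : 0 ≤ u) (ht : 0 < R t) (hΩ : Function.support (homotheticDensity R u t) ⊆ Ω)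
    {f : EuclideanSpace ℝ (Fin d) → ℝ} (hf : Continuous f) :
    ∫ x in Ω, f x * homotheticDensity R u t x =
      ∫ x, f x ∂(homotheticCurve R (volume.withDensity fun x => ENNReal.ofReal (u x)) t) := by
  rw [integral_homotheticCurve _ hf, integral_withDensity_ofReal hu hu₀,
    ← setIntegral_homotheticDensity_mul hΩ ht]
  simp only [mul_comm]

theorem tendsto_integral_homotheticCurve {ν : Measure (EuclideanSpace ℝ (Fin d))}
    [IsFiniteMeasure ν] {l : Filter ℝ} [l.IsCountablyGenerated] (h : Tendsto R l (𝓝 (R t)))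
    (f : BoundedContinuousFunction (EuclideanSpace ℝ (Fin d)) ℝ) :
    Tendsto (fun s => ∫ x, f x ∂(homotheticCurve R ν s)) l
      (𝓝 (∫ x, f x ∂(homotheticCurve R ν t))) := by
  simp only [integral_homotheticCurve ν f.continuous]
  exact tendsto_integral_filter_of_dominated_convergence (fun _ => ‖f‖)
    (Eventually.of_forall fun s => (f.continuous.comp (by fun_prop)).aestronglyMeasurable)
    (Eventually.of_forall fun s => ae_of_all _ fun y => f.norm_coe_le_norm _)
    (integrable_const _)
    (ae_of_all _ fun y => (f.continuous.tendsto _).comp (h.smul_const y))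

theorem noFlux_of_support_subset {u : ℝ → EuclideanSpace ℝ (Fin d) → ℝ}
    (hu : ∀ t ∈ Ioo (0 : ℝ) 1, Continuous (u t))
    (hΩ : ∀ t ∈ Ioo (0 : ℝ) 1, Function.support (u t) ⊆ Ω)
    (v : ℝ → EuclideanSpace ℝ (Fin d) → EuclideanSpace ℝ (Fin d)) : NoFlux Ω u v := by
  intro t ht x hx n _
  have hux : u t x = 0 := Function.notMem_support.1 fun h =>
    hx.2 (interior_maximal (hΩ t ht) (hu t ht).isOpen_support h)
  rw [hux, zero_smul, inner_zero_left]

end HomotheticDensity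

section BarenblattProfile

variable {F : Type*} [NormedAddCommGroup F] [InnerProductSpace ℝ F] {c : ℝ}

/-- Compactly supported profiles `u` with `∇u² = -c u x`, the stationary states of the rescaled
porous medium equation. The square is differentiated, rather than `u`, because `u` has a kink on
the boundary of its support. -/
structure IsBarenblattProfile (c : ℝ) (u : F → ℝ) : Prop where
  continuous : Continuous u
  hasCompactSupport : HasCompactSupport u
  nonneg : 0 ≤ u
  hasFDerivAt_sq : ∀ x, HasFDerivAt (fun y => u y ^ 2) (-(c * u x) • innerSL ℝ x) x

theorem hasDerivAt_max_zero_sq (s : ℝ) :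
    HasDerivAt (fun r : ℝ => max r 0 ^ 2) (2 * max s 0) s := by
  rcases lt_trichotomy s 0 with hs | rfl | hs
  · have hev : (fun r : ℝ => max r 0 ^ 2) =ᶠ[𝓝 s] fun _ => 0 := by
      filter_upwards [Iio_mem_nhds hs] with r hr
      simp [max_eq_right (mem_Iio.1 hr).le]
    rw [max_eq_right hs.le, mul_zero]
    exact (hasDerivAt_const s (0 : ℝ)).congr_of_eventuallyEq hev
  · have hsq : (fun r : ℝ => max r 0 ^ 2) =O[𝓝 0] fun r : ℝ => r ^ 2 := by
      refine Asymptotics.isBigO_of_le _ fun r => ?_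
      rcases le_total r 0 with h | h <;> simp [h, sq_nonneg]
    rw [hasDerivAt_iff_isLittleO]
    simpa using hsq.trans_isLittleO (Asymptotics.isLittleO_pow_id one_lt_two)
  · have hev : (fun r : ℝ => max r 0 ^ 2) =ᶠ[𝓝 s] fun r => r ^ 2 := by
      filter_upwards [Ioi_mem_nhds hs] with r hr
      rw [max_eq_left (mem_Ioi.1 hr).le]
    rw [max_eq_left hs.le]
    simpa using (hasDerivAt_pow 2 s).congr_of_eventuallyEq hev

theorem continuous_parabolicDensity (A ρ : ℝ) :
    Continuous (parabolicDensity A ρ : EuclideanSpace ℝ (Fin d) → ℝ) := by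
  unfold parabolicDensity
  fun_prop

theorem parabolicDensity_eq_zero_of_le_norm {ρ : ℝ} (hρ : 0 ≤ ρ) (A : ℝ)
    {x : EuclideanSpace ℝ (Fin d)} (hx : ρ ≤ ‖x‖) : parabolicDensity A ρ x = 0 := by
  rw [parabolicDensity, max_eq_right (sub_nonpos.2 (by gcongr)), mul_zero]

theorem parabolicDensity_zero_pos {A ρ : ℝ} (hA : 0 < A) (hρ : ρ ≠ 0) :
    0 < parabolicDensity A ρ (0 : EuclideanSpace ℝ (Fin d)) := by
  rw [parabolicDensity, norm_zero, zero_pow two_ne_zero, sub_zero, max_eq_left (sq_nonneg ρ)]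
  positivity

theorem hasFDerivAt_parabolicDensity_sq (A ρ : ℝ) (x : EuclideanSpace ℝ (Fin d)) :
    HasFDerivAt (fun y => parabolicDensity A ρ y ^ 2)
      (-(4 * A * parabolicDensity A ρ x) • innerSL ℝ x) x := by
  have hnorm : HasFDerivAt (fun y : EuclideanSpace ℝ (Fin d) => ρ ^ 2 - ‖y‖ ^ 2)
      (-(2 • innerSL ℝ x)) x := (hasStrictFDerivAt_norm_sq x).hasFDerivAt.const_sub (ρ ^ 2)
  have hsq := ((hasDerivAt_max_zero_sq (ρ ^ 2 - ‖x‖ ^ 2)).comp_hasFDerivAt x hnorm).const_mul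
    (A ^ 2)
  simp only [parabolicDensity, mul_pow]
  refine hsq.congr_fderiv ?_
  ext w
  simp
  ring

theorem isBarenblattProfile_parabolicDensity {A ρ : ℝ} (hA : 0 ≤ A) (hρ : 0 ≤ ρ) :
    IsBarenblattProfile (4 * A)
      (parabolicDensity A ρ : EuclideanSpace ℝ (Fin d) → ℝ) where
  continuous := continuous_parabolicDensity A ρ
  hasCompactSupport := HasCompactSupport.intro (isCompact_closedBall 0 ρ) fun x hx =>
    parabolicDensity_eq_zero_of_le_norm hρ A (by simpa using (not_le.1 (by simpa using hx)).le)
  nonneg _ := mul_nonneg hA (le_max_right _ _)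
  hasFDerivAt_sq := hasFDerivAt_parabolicDensity_sq A ρ

theorem isBarenblattProfile_homotheticDensity {u : EuclideanSpace ℝ (Fin d) → ℝ}
    (hu : IsBarenblattProfile c u) {R : ℝ → ℝ} {t : ℝ} (ht : 0 < R t) :
    IsBarenblattProfile (c * (R t ^ (d + 2))⁻¹) (homotheticDensity R u t) where
  continuous := continuous_homotheticDensity hu.continuous t
  hasCompactSupport := (hu.hasCompactSupport.comp_smul (inv_ne_zero ht.ne')).mul_left
  nonneg := homotheticDensity_nonneg hu.nonneg ht.le
  hasFDerivAt_sq x := by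
    have hscale : HasFDerivAt (fun y : EuclideanSpace ℝ (Fin d) => (R t)⁻¹ • y)
        ((R t)⁻¹ • ContinuousLinearMap.id ℝ _) x :=
      ((R t)⁻¹ • ContinuousLinearMap.id ℝ (EuclideanSpace ℝ (Fin d))).hasFDerivAt
    have hsq := ((hu.hasFDerivAt_sq ((R t)⁻¹ • x)).comp x hscale).const_mul ((R t ^ d)⁻¹ ^ 2)
    simp only [homotheticDensity, mul_pow]
    refine hsq.congr_fderiv ?_
    ext w
    simp
    field_simp
    ring

theorem IsBarenblattProfile.integrable_mul [MeasurableSpace F] [BorelSpace F] {μ : Measure F}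
    [IsFiniteMeasureOnCompacts μ] {u f : F → ℝ} (hu : IsBarenblattProfile c u)
    (hf : Continuous f) : Integrable (fun y => u y * f y) μ :=
  (hu.continuous.mul hf).integrable_of_hasCompactSupport hu.hasCompactSupport.mul_right

theorem IsBarenblattProfile.integrable_sq_mul [MeasurableSpace F] [BorelSpace F] {μ : Measure F}
    [IsFiniteMeasureOnCompacts μ] {u f : F → ℝ} (hu : IsBarenblattProfile c u)
    (hf : Continuous f) : Integrable (fun y => u y ^ 2 * f y) μ := by
  simpa only [sq, mul_assoc, Pi.mul_apply] using hu.integrable_mul (hu.continuous.mul hf)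

theorem IsBarenblattProfile.integral_sq_mul_fderiv [FiniteDimensional ℝ F] [MeasurableSpace F]
    [BorelSpace F] {u : F → ℝ} (hu : IsBarenblattProfile c u) {ψ : F → ℝ}
    (hψ : ContDiff ℝ 1 ψ) (w : F) :
    ∫ y, u y ^ 2 * fderiv ℝ ψ y w = c * ∫ y, u y * (inner ℝ y w * ψ y) := by
  have hψ' : Continuous fun y => fderiv ℝ ψ y w :=
    (hψ.continuous_fderiv one_ne_zero).clm_apply continuous_const
  have hderiv (y : F) : fderiv ℝ (fun z => u z ^ 2) y w * ψ y
      = -(c * (u y * (inner ℝ y w * ψ y))) := by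
    rw [(hu.hasFDerivAt_sq y).fderiv, _root_.smul_apply, innerSL_apply_apply,
      smul_eq_mul]
    ring
  rw [integral_mul_fderiv_eq_neg_fderiv_mul_of_integrable (f := fun y => u y ^ 2)]
  · simp only [hderiv, integral_neg, neg_neg, integral_const_mul]
  · simp only [hderiv]
    exact ((hu.integrable_mul ((continuous_id.inner continuous_const).mul
      hψ.continuous)).const_mul c).neg
  · exact hu.integrable_sq_mul hψ'
  · exact hu.integrable_sq_mul hψ.continuous
  · exact fun y _ => (hu.hasFDerivAt_sq y).differentiableAt
  · exact fun y _ => hψ.differentiable one_ne_zero y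

theorem IsBarenblattProfile.integral_sq_mul_div {u : EuclideanSpace ℝ (Fin d) → ℝ}
    (hu : IsBarenblattProfile c u)
    {η : EuclideanSpace ℝ (Fin d) → EuclideanSpace ℝ (Fin d)} (hη : ContDiff ℝ 1 η) :
    ∫ y, u y ^ 2 * ∑ i, (fderiv ℝ η y (EuclideanSpace.single i 1)) i
      = c * ∫ y, u y * inner ℝ y (η y) := by
  have hηi (i : Fin d) : ContDiff ℝ 1 fun y => η y i :=
    (EuclideanSpace.proj (𝕜 := ℝ) i).contDiff.comp hη
  have hcoord (i : Fin d) (y : EuclideanSpace ℝ (Fin d)) :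
      (fderiv ℝ η y (EuclideanSpace.single i 1)) i
        = fderiv ℝ (fun z => η z i) y (EuclideanSpace.single i 1) := by
    have hproj : HasFDerivAt (fun z => η z i)
        ((EuclideanSpace.proj (𝕜 := ℝ) i).comp (fderiv ℝ η y)) y :=
      (EuclideanSpace.proj (𝕜 := ℝ) i).hasFDerivAt.comp y
        (hη.differentiable one_ne_zero y).hasFDerivAt
    rw [hproj.fderiv]
    rfl
  have hint₁ (i : Fin d) : Integrable fun y =>
      u y ^ 2 * fderiv ℝ (fun z => η z i) y (EuclideanSpace.single i 1) :=
    hu.integrable_sq_mul (((hηi i).continuous_fderiv one_ne_zero).clm_apply continuous_const)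
  have hint₂ (i : Fin d) : Integrable fun y =>
      u y * (inner ℝ y (EuclideanSpace.single i 1) * η y i) :=
    hu.integrable_mul ((continuous_id.inner continuous_const).mul (hηi i).continuous)
  calc ∫ y, u y ^ 2 * ∑ i, (fderiv ℝ η y (EuclideanSpace.single i 1)) i
      = ∑ i, ∫ y, u y ^ 2 * fderiv ℝ (fun z => η z i) y (EuclideanSpace.single i 1) := by
        simp only [Finset.mul_sum, hcoord]
        exact integral_finsetSum _ fun i _ => hint₁ i
    _ = c * ∑ i, ∫ y, u y * (inner ℝ y (EuclideanSpace.single i 1) * η y i) := by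
        simp only [hu.integral_sq_mul_fderiv (hηi _), Finset.mul_sum]
    _ = c * ∫ y, u y * inner ℝ y (η y) := by
        rw [← integral_finsetSum _ fun i _ => hint₂ i]
        simp only [← Finset.mul_sum, PiLp.inner_apply]
        simp [mul_comm]

theorem IsBarenblattProfile.dim_mul_integral_sq {u : EuclideanSpace ℝ (Fin d) → ℝ}
    (hu : IsBarenblattProfile c u) :
    d * ∫ y, u y ^ 2 = c * ∫ y, u y * ‖y‖ ^ 2 := by
  have hid := hu.integral_sq_mul_div (η := id) contDiff_id
  simp only [id_eq, fderiv_id, real_inner_self_eq_norm_sq] at hid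
  rw [← hid, ← integral_const_mul]
  simp [mul_comm]

theorem integral_mul_norm_sq_pos [FiniteDimensional ℝ F] [Nontrivial F] [MeasurableSpace F]
    [BorelSpace F] {u : F → ℝ} (hu : Continuous u) (huc : HasCompactSupport u) (hu₀ : 0 ≤ u)
    (hne : u ≠ 0) : 0 < ∫ y, u y * ‖y‖ ^ 2 := by
  obtain ⟨x, hx, hx₀⟩ := (dense_compl_singleton (0 : F)).exists_mem_open hu.isOpen_support
    (Function.support_nonempty_iff.2 hne)
  exact (hu.mul (by fun_prop)).integral_pos_of_hasCompactSupport_nonneg_nonzero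
    huc.mul_right (fun y => mul_nonneg (hu₀ y) (sq_nonneg _))
    (mul_ne_zero hx₀ (pow_ne_zero _ (norm_ne_zero_iff.2 hx)))

end BarenblattProfile

section Energies

variable {R : ℝ → ℝ} {t : ℝ} {u : EuclideanSpace ℝ (Fin d) → ℝ}
  {Ω : Set (EuclideanSpace ℝ (Fin d))}

theorem energyF_homotheticDensity (ht : 0 < R t)
    (hΩ : Function.support (homotheticDensity R u t) ⊆ Ω) :
    energyF Ω 2 (homotheticDensity R u) t = (R t ^ d)⁻¹ * ∫ y, u y ^ 2 := by
  simp only [energyF, Real.rpow_two, sq]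
  rw [setIntegral_homotheticDensity_mul hΩ ht, ← integral_const_mul]
  simp only [homotheticDensity_smul ht.ne', mul_left_comm]

theorem energyV_homotheticField (ht : 0 < R t)
    (hΩ : Function.support (homotheticDensity R u t) ⊆ Ω) :
    energyV Ω 2 (homotheticDensity R u) (homotheticField R) t
      = derivWithin R (Icc 0 1) t ^ 2 * ∫ y, u y * ‖y‖ ^ 2 := by
  simp only [energyV, Real.rpow_two, mul_comm (‖_‖ ^ 2) (homotheticDensity R u t _)]
  rw [setIntegral_homotheticDensity_mul hΩ ht, ← integral_const_mul]
  simp only [homotheticField_smul ht.ne', norm_smul, mul_pow, Real.norm_eq_abs, sq_abs,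
    mul_left_comm]

theorem energyV_homotheticField_rpow_half (ht : 0 < R t)
    (hΩ : Function.support (homotheticDensity R u t) ⊆ Ω) :
    energyV Ω 2 (homotheticDensity R u) (homotheticField R) t ^ (1 / 2 : ℝ)
      = |derivWithin R (Icc 0 1) t| * √(∫ y, u y * ‖y‖ ^ 2) := by
  rw [energyV_homotheticField ht hΩ, ← Real.sqrt_eq_rpow, Real.sqrt_mul (sq_nonneg _),
    Real.sqrt_sq_eq_abs]

theorem coeffH_homothetic (ht : 0 < R t)
    (hΩ : Function.support (homotheticDensity R u t) ⊆ Ω) :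
    coeffH Ω 2 2 1 (1 / 2) (homotheticDensity R u) (homotheticField R) t
      = -(|derivWithin R (Icc 0 1) t| * √(∫ y, u y * ‖y‖ ^ 2)) := by
  rw [coeffH, energyV_homotheticField_rpow_half ht hΩ, sub_self, Real.rpow_zero]
  ring

theorem coeffK_homothetic (hu₀ : 0 ≤ u) (ht : 0 < R t)
    (hΩ : Function.support (homotheticDensity R u t) ⊆ Ω) :
    coeffK Ω 2 2 1 (1 / 2) (homotheticDensity R u) (homotheticField R) t
      = (R t ^ d)⁻¹ * (∫ y, u y ^ 2) *
        (|derivWithin R (Icc 0 1) t| * √(∫ y, u y * ‖y‖ ^ 2))⁻¹ := by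
  have hV : 0 ≤ energyV Ω 2 (homotheticDensity R u) (homotheticField R) t := by
    rw [energyV_homotheticField ht hΩ]
    exact mul_nonneg (sq_nonneg _) (integral_nonneg fun y => mul_nonneg (hu₀ y) (sq_nonneg _))
  rw [coeffK, show (1 / 2 - 1 : ℝ) = -(1 / 2) by norm_num, Real.rpow_neg hV,
    energyV_homotheticField_rpow_half ht hΩ, energyF_homotheticDensity ht hΩ, Real.rpow_one]
  ring

/-- The constant `F̄ / √m`, where `F̄ = ∫ ū²` and `m = ∫ ū |y|²`, to which the momentum `K(t) v_t`
of the homothetic curve with profile `ū` is proportional. -/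
noncomputable def momentumConst (u : EuclideanSpace ℝ (Fin d) → ℝ) : ℝ :=
  (∫ y, u y ^ 2) / √(∫ y, u y * ‖y‖ ^ 2)

/-- The field `K(t) v_t` of a homothetic curve. It is affected by `R'` only through the constant
`κ`, a multiple of the sign of `R'`, so it extends continuously across the zeros of `R'`. -/
noncomputable def momentumField (R : ℝ → ℝ) (κ t : ℝ) (x : EuclideanSpace ℝ (Fin d)) :
    EuclideanSpace ℝ (Fin d) :=
  (κ * (R t ^ (d + 1))⁻¹) • x

theorem momentumField_smul (κ : ℝ) (ht : R t ≠ 0) (y : EuclideanSpace ℝ (Fin d)) :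
    momentumField R κ t (R t • y) = (κ * (R t ^ d)⁻¹) • y := by
  rw [momentumField, smul_smul]
  congr 1
  field_simp
  ring

theorem coeffK_smul_homotheticField (hu₀ : 0 ≤ u) (ht : 0 < R t)
    (hΩ : Function.support (homotheticDensity R u t) ⊆ Ω) (x : EuclideanSpace ℝ (Fin d)) :
    coeffK Ω 2 2 1 (1 / 2) (homotheticDensity R u) (homotheticField R) t • homotheticField R t x
      = momentumField R (SignType.sign (derivWithin R (Icc 0 1) t) * momentumConst u) t x := by
  rw [coeffK_homothetic hu₀ ht hΩ, homotheticField, momentumField, momentumConst, smul_smul]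
  congr 1
  rcases eq_or_ne (derivWithin R (Icc 0 1) t) 0 with h | h
  · simp [h]
  · have habs : |derivWithin R (Icc 0 1) t| ≠ 0 := abs_ne_zero.2 h
    nth_rw 2 [← sign_mul_abs (derivWithin R (Icc 0 1) t)]
    field_simp
    ring

end Energies

section SpaceTime

variable {E F : Type*} [NormedAddCommGroup E] [NormedAddCommGroup F]

theorem ae_restrict_prod_of_ae_fst {α β : Type*} [MeasurableSpace α] [MeasurableSpace β]
    {μ : Measure α} {ν : Measure β} [SFinite μ] [SFinite ν] {I : Set α} {p : α → Prop}
    (h : ∀ᵐ t ∂(μ.restrict I), p t) (S : Set β) :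
    ∀ᵐ z ∂((μ.prod ν).restrict (I ×ˢ S)), p z.1 := by
  rw [← Measure.prod_restrict]
  exact Measure.quasiMeasurePreserving_fst.ae h

theorem locallyIntegrableOn_prod_of_ae_eq_continuousOn [MeasureSpace E] [OpensMeasurableSpace E]
    [SecondCountableTopology E] [IsLocallyFiniteMeasure (volume : Measure E)]
    [SFinite (volume : Measure E)] {I : Set ℝ} {S : Set E} {f g : ℝ × E → F}
    (hI : MeasurableSet I) (hS : MeasurableSet S) (hg : ContinuousOn g (I ×ˢ univ))
    (hfg : ∀ᵐ t ∂(volume.restrict I), ∀ x, f (t, x) = g (t, x)) :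
    LocallyIntegrableOn f (I ×ˢ S) := by
  have hloc : LocallyIntegrableOn g (I ×ˢ S) :=
    (hg.mono (prod_mono_right (subset_univ S))).locallyIntegrableOn (hI.prod hS)
  refine hloc.congr ?_
  filter_upwards [ae_restrict_prod_of_ae_fst hfg S] with z hz using (hz z.2).symm

theorem continuousOn_comp_fst {α β γ : Type*} [TopologicalSpace α] [TopologicalSpace β]
    [TopologicalSpace γ] {I : Set α} {f : α → γ} (hf : ContinuousOn f I) :
    ContinuousOn (fun z : α × β => f z.1) (I ×ˢ univ) :=
  hf.comp continuousOn_fst fun _ hz => hz.1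

theorem integrable_of_continuousOn_of_support_subset {α : Type*} [TopologicalSpace α]
    [MeasurableSpace α] [OpensMeasurableSpace α] [T2Space α] {μ : Measure α}
    [IsFiniteMeasureOnCompacts μ] {f : α → F} {K : Set α} (hK : IsCompact K) (hf : ContinuousOn f K)
    (hsupp : Function.support f ⊆ K) : Integrable f μ :=
  (integrableOn_iff_integrable_of_support_subset hsupp).1 (hf.integrableOn_compact hK)

variable [NormedSpace ℝ E] [NormedSpace ℝ F] {ξ : ℝ × E → F} {t : ℝ} {x : E}

theorem deriv_fst_add_fderiv_snd (hξ : DifferentiableAt ℝ ξ (t, x)) (w : E) :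
    deriv (fun s => ξ (s, x)) t + fderiv ℝ (fun y => ξ (t, y)) x w
      = fderiv ℝ ξ (t, x) (1, w) := by
  have htime : HasDerivAt (fun s => ξ (s, x)) (fderiv ℝ ξ (t, x) (1, 0)) t :=
    hξ.hasFDerivAt.comp_hasDerivAt t ((hasDerivAt_id t).prodMk (hasDerivAt_const t x))
  have hspace : HasFDerivAt (fun y => ξ (t, y)) ((fderiv ℝ ξ (t, x)).comp
      (ContinuousLinearMap.inr ℝ ℝ E)) x := hξ.hasFDerivAt.comp x (hasFDerivAt_prodMk_right t x)
  rw [htime.deriv, hspace.fderiv, ContinuousLinearMap.comp_apply, ContinuousLinearMap.inr_apply,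
    ← map_add, Prod.mk_add_mk, add_zero, zero_add]

theorem spaceDiv_eq_zero_of_notMem_tsupport
    {ξ : ℝ × EuclideanSpace ℝ (Fin d) → EuclideanSpace ℝ (Fin d)}
    {z : ℝ × EuclideanSpace ℝ (Fin d)} (hz : z ∉ tsupport ξ) : spaceDiv ξ z.1 z.2 = 0 := by
  have hev : (fun y => ξ (z.1, y)) =ᶠ[𝓝 z.2] 0 :=
    (Continuous.prodMk_right z.1).continuousAt.eventually (notMem_tsupport_iff_eventuallyEq.1 hz)
  simp [spaceDiv, hev.fderiv_eq]

theorem continuous_spaceDiv {ξ : ℝ × EuclideanSpace ℝ (Fin d) → EuclideanSpace ℝ (Fin d)}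
    (hξ : ContDiff ℝ 1 ξ) :
    Continuous fun z : ℝ × EuclideanSpace ℝ (Fin d) => spaceDiv ξ z.1 z.2 := by
  have hsection (z : ℝ × EuclideanSpace ℝ (Fin d)) (w : EuclideanSpace ℝ (Fin d)) :
      fderiv ℝ (fun y => ξ (z.1, y)) z.2 w = fderiv ℝ ξ z (0, w) := by
    have hcomp : HasFDerivAt (fun y => ξ (z.1, y))
        ((fderiv ℝ ξ z).comp (ContinuousLinearMap.inr ℝ ℝ _)) z.2 :=
      (hξ.differentiable one_ne_zero z).hasFDerivAt.comp z.2 (hasFDerivAt_prodMk_right z.1 z.2)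
    exact DFunLike.congr_fun hcomp.fderiv w
  simp only [spaceDiv, hsection]
  exact continuous_finsetSum _ fun i _ => (EuclideanSpace.proj (𝕜 := ℝ) i).continuous.comp
    ((hξ.continuous_fderiv one_ne_zero).clm_apply continuous_const)

end SpaceTime

section Characteristics

variable {R : ℝ → ℝ} {u : EuclideanSpace ℝ (Fin d) → ℝ}

theorem continuousOn_homotheticDensity_uncurry {I : Set ℝ} (hu : Continuous u)
    (hR : ContinuousOn R I) (hR₀ : ∀ t ∈ I, R t ≠ 0) :
    ContinuousOn (fun z : ℝ × EuclideanSpace ℝ (Fin d) => homotheticDensity R u z.1 z.2)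
      (I ×ˢ univ) := by
  have hRz := continuousOn_comp_fst (β := EuclideanSpace ℝ (Fin d)) hR
  unfold homotheticDensity
  exact ((hRz.pow d).inv₀ fun z hz => pow_ne_zero _ (hR₀ _ hz.1)).mul
    (hu.comp_continuousOn ((hRz.inv₀ fun z hz => hR₀ _ hz.1).smul continuousOn_snd))

theorem continuousOn_homotheticField_uncurry (hR : ContDiffOn ℝ 1 R (Icc 0 1))
    (hR₀ : ∀ t ∈ Ioo (0 : ℝ) 1, R t ≠ 0) :
    ContinuousOn (fun z : ℝ × EuclideanSpace ℝ (Fin d) => homotheticField R z.1 z.2)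
      (Ioo 0 1 ×ˢ univ) :=
  (continuousOn_comp_fst (((continuousOn_derivWithin_Icc hR).mono Ioo_subset_Icc_self).div
    (hR.continuousOn.mono Ioo_subset_Icc_self) hR₀)).smul continuousOn_snd

theorem continuousOn_momentumField_uncurry {I : Set ℝ} (hR : ContinuousOn R I)
    (hR₀ : ∀ t ∈ I, R t ≠ 0) (κ : ℝ) :
    ContinuousOn (fun z : ℝ × EuclideanSpace ℝ (Fin d) => momentumField R κ z.1 z.2)
      (I ×ˢ univ) :=
  (continuousOn_comp_fst (continuousOn_const.mul
    ((hR.pow (d + 1)).inv₀ fun t ht => pow_ne_zero _ (hR₀ t ht)))).smul continuousOn_snd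

section MaterialDeriv

variable {F : Type*} [NormedAddCommGroup F] [NormedSpace ℝ F]
  {ξ : ℝ × EuclideanSpace ℝ (Fin d) → F}

/-- The material derivative `∂ₜξ + (v · ∇)ξ` along the flow `s ↦ R s • y` of the field
`v = homotheticField R`, as a function on space-time. -/
noncomputable def materialDeriv (R : ℝ → ℝ) (ξ : ℝ × EuclideanSpace ℝ (Fin d) → F)
    (z : ℝ × EuclideanSpace ℝ (Fin d)) : F :=
  fderiv ℝ ξ z (1, homotheticField R z.1 z.2)

theorem deriv_add_fderiv_homotheticField_eq_materialDeriv (hξ : Differentiable ℝ ξ)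
    (z : ℝ × EuclideanSpace ℝ (Fin d)) :
    deriv (fun s => ξ (s, z.2)) z.1
      + fderiv ℝ (fun y => ξ (z.1, y)) z.2 (homotheticField R z.1 z.2) = materialDeriv R ξ z :=
  deriv_fst_add_fderiv_snd (hξ z) _

theorem materialDeriv_of_notMem_tsupport {z : ℝ × EuclideanSpace ℝ (Fin d)}
    (hz : z ∉ tsupport ξ) : materialDeriv R ξ z = 0 := by
  rw [materialDeriv, fderiv_of_notMem_tsupport ℝ hz, _root_.zero_apply]

theorem continuousOn_materialDeriv (hR : ContDiffOn ℝ 1 R (Icc 0 1))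
    (hR₀ : ∀ t ∈ Ioo (0 : ℝ) 1, R t ≠ 0) (hξ : ContDiff ℝ 1 ξ) :
    ContinuousOn (materialDeriv R ξ) (Ioo 0 1 ×ˢ univ) :=
  (hξ.continuous_fderiv one_ne_zero).continuousOn.clm_apply
    (continuousOn_const.prodMk (continuousOn_homotheticField_uncurry hR hR₀))

theorem continuous_materialDeriv_slice (hξ : ContDiff ℝ 1 ξ) (t : ℝ) :
    Continuous fun x => materialDeriv R ξ (t, x) :=
  ((hξ.continuous_fderiv one_ne_zero).comp (Continuous.prodMk_right t)).clm_apply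
    (continuous_const.prodMk (continuous_homotheticField t))

theorem hasDerivAt_along_homothety (hξ : Differentiable ℝ ξ) (hR : ContDiffOn ℝ 1 R (Icc 0 1))
    {t : ℝ} (ht : t ∈ Ioo (0 : ℝ) 1) (hRt : R t ≠ 0) (y : EuclideanSpace ℝ (Fin d)) :
    HasDerivAt (fun s => ξ (s, R s • y)) (materialDeriv R ξ (t, R t • y)) t :=
  (hξ (t, R t • y)).hasFDerivAt.comp_hasDerivAt t
    ((hasDerivAt_id t).prodMk (hasDerivAt_smul_homotheticField hR ht hRt y))

end MaterialDeriv

theorem hasDerivAt_momentumField_along_homothety (hR : ContDiffOn ℝ 1 R (Icc 0 1)) {t : ℝ}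
    (ht : t ∈ Ioo (0 : ℝ) 1) (hRt : R t ≠ 0) (κ : ℝ) (y : EuclideanSpace ℝ (Fin d)) :
    HasDerivAt (fun s => momentumField R κ s (R s • y))
      (-(d * (derivWithin R (Icc 0 1) t / R t)) • momentumField R κ t (R t • y)) t := by
  have hderiv := hasDerivAt_derivWithin_Icc hR ht
  have hev : (fun s => momentumField R κ s (R s • y)) =ᶠ[𝓝 t]
      fun s => (κ * (R s ^ d)⁻¹) • y := by
    filter_upwards [hderiv.continuousAt.eventually_ne hRt] with s hs
      using momentumField_smul κ hs y
  have hpow := (((hderiv.fun_pow d).fun_inv (pow_ne_zero d hRt)).const_mul κ).smul_const y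
  refine (hpow.congr_of_eventuallyEq hev).congr_deriv ?_
  rw [momentumField_smul κ hRt, smul_smul]
  congr 1
  rcases d with _ | n
  · simp
  · simp only [Nat.add_sub_cancel]
    field_simp
    ring

theorem intervalIntegral_integral_mul_deriv_along_homothety_eq_zero (hu : Continuous u)
    (huc : HasCompactSupport u) (hR : ContinuousOn R (Ioo 0 1)) {T : Set ℝ} (hT : IsCompact T)
    (hTsub : T ⊆ Ioo 0 1) {h h' : ℝ × EuclideanSpace ℝ (Fin d) → ℝ}
    (hh : ∀ t ∉ T, ∀ x, h (t, x) = 0) (hh' : ∀ t ∉ T, ∀ x, h' (t, x) = 0)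
    (hcont : ContinuousOn h' (Ioo 0 1 ×ˢ univ))
    (hderiv : ∀ t ∈ Ioo (0 : ℝ) 1, ∀ y,
      HasDerivAt (fun s => h (s, R s • y)) (h' (t, R t • y)) t) :
    ∫ t in (0 : ℝ)..1, ∫ y, u y * h' (t, R t • y) = 0 := by
  have hflow : ContinuousOn (fun z : ℝ × EuclideanSpace ℝ (Fin d) => h' (z.1, R z.1 • z.2))
      (Ioo 0 1 ×ˢ univ) :=
    hcont.comp (continuousOn_fst.prodMk ((continuousOn_comp_fst hR).smul continuousOn_snd))
      fun z hz => ⟨hz.1, mem_univ _⟩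
  have hint : Integrable (fun z : ℝ × EuclideanSpace ℝ (Fin d) => u z.2 * h' (z.1, R z.1 • z.2))
      (volume.prod volume) := by
    refine integrable_of_continuousOn_of_support_subset (hT.prod huc)
      (((hu.comp continuous_snd).continuousOn.mul hflow).mono
        (prod_mono hTsub (subset_univ _))) fun z hz => ⟨?_, ?_⟩
    · by_contra hzT
      exact hz (by simp only [hh' _ hzT, mul_zero])
    · exact subset_tsupport _ (left_ne_zero_of_mul hz)
  have hend (t₀ : ℝ) (ht₀ : t₀ ∉ Ioo (0 : ℝ) 1) (S : Set ℝ) (y : EuclideanSpace ℝ (Fin d)) :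
      Tendsto (fun s => u y * h (s, R s • y)) (𝓝[S] t₀) (𝓝 0) := by
    refine tendsto_const_nhds.congr' ?_
    filter_upwards [nhdsWithin_le_nhds (hT.isClosed.isOpen_compl.mem_nhds
      fun h => ht₀ (hTsub h))] with s hs
    rw [hh s hs, mul_zero]
  rw [intervalIntegral_integral_eq_integral_sub zero_lt_one
    (hint.mono_measure (Measure.prod_mono Measure.restrict_le_self le_rfl))
    (fun y t ht => (hderiv t ht y).const_mul (u y)) (hend 0 (by simp) _) (hend 1 (by simp) _)]
  simp

theorem intervalIntegral_setIntegral_mul_deriv_along_homothety_eq_zero (hu : Continuous u)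
    (huc : HasCompactSupport u) (hR : ContinuousOn R (Ioo 0 1))
    (hRpos : ∀ t ∈ Ioo (0 : ℝ) 1, 0 < R t) {Ω : Set (EuclideanSpace ℝ (Fin d))}
    (hsupp : ∀ t ∈ Ioo (0 : ℝ) 1, Function.support (homotheticDensity R u t) ⊆ Ω)
    {T : Set ℝ} (hT : IsCompact T) (hTsub : T ⊆ Ioo 0 1)
    {h h' : ℝ × EuclideanSpace ℝ (Fin d) → ℝ}
    (hh : ∀ t ∉ T, ∀ x, h (t, x) = 0) (hh' : ∀ t ∉ T, ∀ x, h' (t, x) = 0)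
    (hcont : ContinuousOn h' (Ioo 0 1 ×ˢ univ))
    (hderiv : ∀ t ∈ Ioo (0 : ℝ) 1, ∀ y,
      HasDerivAt (fun s => h (s, R s • y)) (h' (t, R t • y)) t) :
    ∫ t in (0 : ℝ)..1, ∫ x in Ω, homotheticDensity R u t x * h' (t, x) = 0 := by
  refine Eq.trans ?_ (intervalIntegral_integral_mul_deriv_along_homothety_eq_zero hu huc hR hT hTsub
    hh hh' hcont hderiv)
  simp only [intervalIntegral.integral_of_le zero_le_one, integral_Ioc_eq_integral_Ioo]
  exact setIntegral_congr_fun measurableSet_Ioo fun t ht =>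
    setIntegral_homotheticDensity_mul (hsupp t ht) (hRpos t ht) _

end Characteristics

section WeakEquations

variable {R : ℝ → ℝ} {u : EuclideanSpace ℝ (Fin d) → ℝ} {Ω : Set (EuclideanSpace ℝ (Fin d))}

theorem setIntegral_prod_eq_intervalIntegral_of_ae_eq {E F : Type*} [MeasureSpace E]
    [SFinite (volume : Measure E)] [NormedAddCommGroup F] [NormedSpace ℝ F] {S : Set E}
    {a b : ℝ} (hab : a ≤ b) {f g : ℝ × E → F} {G : ℝ → F}
    (hg : Integrable g) (hfg : ∀ᵐ t ∂(volume.restrict (Ioo a b)), ∀ x, f (t, x) = g (t, x))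
    (hG : ∀ᵐ t ∂(volume.restrict (Ioo a b)), ∫ x in S, g (t, x) = G t) :
    ∫ z in Ioo a b ×ˢ S, f z = ∫ t in a..b, G t := by
  have hcongr : ∫ z in Ioo a b ×ˢ S, f z = ∫ z in Ioo a b ×ˢ S, g z := by
    refine integral_congr_ae ?_
    filter_upwards [ae_restrict_prod_of_ae_fst hfg S] with z hz using hz z.2
  rw [hcongr, Measure.volume_eq_prod, setIntegral_prod _ hg.integrableOn,
    intervalIntegral.integral_of_le hab, integral_Ioc_eq_integral_Ioo]
  exact integral_congr_ae hG

theorem setIntegral_homothetic_continuity_eq_zero (hu : Continuous u) (huc : HasCompactSupport u)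
    (hR : ContDiffOn ℝ 1 R (Icc 0 1)) (hRpos : ∀ t ∈ Ioo (0 : ℝ) 1, 0 < R t)
    (hsupp : ∀ t ∈ Ioo (0 : ℝ) 1, Function.support (homotheticDensity R u t) ⊆ Ω)
    {φ : ℝ × EuclideanSpace ℝ (Fin d) → ℝ} (hφ : ContDiff ℝ 1 φ) (hφc : HasCompactSupport φ)
    (hφs : tsupport φ ⊆ Ioo (0 : ℝ) 1 ×ˢ univ) :
    ∫ z in Ioo (0 : ℝ) 1 ×ˢ Ω, homotheticDensity R u z.1 z.2 *
      (deriv (fun s => φ (s, z.2)) z.1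
        + fderiv ℝ (fun y => φ (z.1, y)) z.2 (homotheticField R z.1 z.2)) = 0 := by
  have hR₀ (t : ℝ) (ht : t ∈ Ioo (0 : ℝ) 1) : R t ≠ 0 := (hRpos t ht).ne'
  have hRcont : ContinuousOn R (Ioo 0 1) := hR.continuousOn.mono Ioo_subset_Icc_self
  have hφd : Differentiable ℝ φ := hφ.differentiable one_ne_zero
  have hcont := continuousOn_materialDeriv hR hR₀ hφ
  have hint : Integrable fun z : ℝ × EuclideanSpace ℝ (Fin d) =>
      homotheticDensity R u z.1 z.2 * materialDeriv R φ z := by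
    refine integrable_of_continuousOn_of_support_subset hφc
      (((continuousOn_homotheticDensity_uncurry hu hRcont hR₀).mul hcont).mono hφs)
      fun z hz => ?_
    by_contra hzφ
    exact hz (by simp only [materialDeriv_of_notMem_tsupport hzφ, mul_zero])
  simp only [deriv_add_fderiv_homotheticField_eq_materialDeriv hφd]
  rw [setIntegral_prod_eq_intervalIntegral_of_ae_eq zero_le_one hint
    (ae_of_all _ fun _ _ => rfl) (ae_of_all _ fun _ => rfl)]
  refine intervalIntegral_setIntegral_mul_deriv_along_homothety_eq_zero hu huc hRcont hRpos hsupp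
    (hφc.image continuous_fst) (image_subset_iff.2 fun z hz => (hφs hz).1) ?_ ?_ hcont
    fun t ht y => hasDerivAt_along_homothety hφd hR ht (hR₀ t ht) y
  · exact fun t ht x => image_eq_zero_of_notMem_tsupport fun h => ht ⟨_, h, rfl⟩
  · exact fun t ht x => materialDeriv_of_notMem_tsupport fun h => ht ⟨_, h, rfl⟩

end WeakEquations

section Momentum

variable {c : ℝ} {R : ℝ → ℝ} {u : EuclideanSpace ℝ (Fin d) → ℝ}
  {Ω : Set (EuclideanSpace ℝ (Fin d))} {t : ℝ}
  {ξ : ℝ × EuclideanSpace ℝ (Fin d) → EuclideanSpace ℝ (Fin d)}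

theorem IsBarenblattProfile.sqrt_mul_eq_dim_mul_momentumConst (hu : IsBarenblattProfile c u) :
    √(∫ y, u y * ‖y‖ ^ 2) * c = d * momentumConst u := by
  rw [momentumConst, ← mul_div_assoc, hu.dim_mul_integral_sq, mul_div_assoc, Real.div_sqrt,
    mul_comm]

theorem IsBarenblattProfile.setIntegral_pressure_eq (hu : IsBarenblattProfile c u)
    (ht : 0 < R t) (hsupp : Function.support (homotheticDensity R u t) ⊆ Ω)
    (hξ : ContDiff ℝ 1 ξ) :
    ∫ x in Ω, homotheticDensity R u t x ^ 2 *
        (-(|derivWithin R (Icc 0 1) t| * √(∫ y, u y * ‖y‖ ^ 2)) * spaceDiv ξ t x)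
      = ∫ x in Ω, homotheticDensity R u t x *
        inner ℝ (-(d * (derivWithin R (Icc 0 1) t / R t)) •
          momentumField R (SignType.sign (derivWithin R (Icc 0 1) t) * momentumConst u) t x)
          (ξ (t, x)) := by
  have hzero (x : EuclideanSpace ℝ (Fin d)) (hx : x ∉ Ω) : homotheticDensity R u t x = 0 :=
    Function.notMem_support.1 fun h => hx (hsupp h)
  have hdiv : ∫ x, homotheticDensity R u t x ^ 2 * spaceDiv ξ t x
      = c * (R t ^ (d + 2))⁻¹ * ∫ x, homotheticDensity R u t x * inner ℝ x (ξ (t, x)) :=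
    (isBarenblattProfile_homotheticDensity hu ht).integral_sq_mul_div
      (hξ.comp (contDiff_prodMk_right t))
  have hconst := hu.sqrt_mul_eq_dim_mul_momentumConst
  rw [setIntegral_eq_integral_of_forall_compl_eq_zero fun x hx => by
      rw [hzero x hx, zero_pow two_ne_zero, zero_mul],
    setIntegral_eq_integral_of_forall_compl_eq_zero fun x hx => by rw [hzero x hx, zero_mul]]
  simp only [momentumField, smul_smul, real_inner_smul_left, mul_left_comm (_ ^ 2),
    mul_left_comm (homotheticDensity R u t _), integral_const_mul]
  rw [hdiv, ← sign_mul_self]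
  field_simp
  linear_combination (-(SignType.sign (derivWithin R (Icc 0 1) t) : ℝ) *
    derivWithin R (Icc 0 1) t * R t ^ (d + 2) *
    ∫ x, homotheticDensity R u t x * inner ℝ x (ξ (t, x))) * hconst

theorem momentum_integrand_homothetic_eq (hu₀ : 0 ≤ u) (ht : 0 < R t)
    (hsupp : Function.support (homotheticDensity R u t) ⊆ Ω) (hξ : Differentiable ℝ ξ)
    (x : EuclideanSpace ℝ (Fin d)) :
    coeffH Ω 2 2 1 (1 / 2) (homotheticDensity R u) (homotheticField R) t
          * homotheticDensity R u t x ^ (2 : ℝ) * spaceDiv ξ t x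
        + coeffK Ω 2 2 1 (1 / 2) (homotheticDensity R u) (homotheticField R) t
          * homotheticDensity R u t x * ‖homotheticField R t x‖ ^ (2 - 2 : ℝ) *
          (inner ℝ (homotheticField R t x)
            (fderiv ℝ (fun y => ξ (t, y)) x (homotheticField R t x))
            + inner ℝ (homotheticField R t x) (deriv (fun s => ξ (s, x)) t))
      = homotheticDensity R u t x ^ 2 *
          (-(|derivWithin R (Icc 0 1) t| * √(∫ y, u y * ‖y‖ ^ 2)) * spaceDiv ξ t x)
        + homotheticDensity R u t x * inner ℝ
          (momentumField R (SignType.sign (derivWithin R (Icc 0 1) t) * momentumConst u) t x)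
          (materialDeriv R ξ (t, x)) := by
  rw [← coeffK_smul_homotheticField hu₀ ht hsupp, real_inner_smul_left,
    ← deriv_add_fderiv_homotheticField_eq_materialDeriv hξ, inner_add_right,
    coeffH_homothetic ht hsupp, sub_self, Real.rpow_zero, Real.rpow_two]
  ring

theorem IsBarenblattProfile.setIntegral_momentum_eq (hu : IsBarenblattProfile c u)
    (ht : 0 < R t) (hsupp : Function.support (homotheticDensity R u t) ⊆ Ω)
    (hξ : ContDiff ℝ 1 ξ) {κ : ℝ}
    (hκ : SignType.sign (derivWithin R (Icc 0 1) t) * momentumConst u = κ) :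
    ∫ x in Ω, (homotheticDensity R u t x ^ 2 *
          (-(|derivWithin R (Icc 0 1) t| * √(∫ y, u y * ‖y‖ ^ 2)) * spaceDiv ξ t x)
        + homotheticDensity R u t x *
          inner ℝ (momentumField R κ t x) (materialDeriv R ξ (t, x)))
      = ∫ x in Ω, homotheticDensity R u t x *
        (inner ℝ (momentumField R κ t x) (materialDeriv R ξ (t, x))
          + inner ℝ (-(d * (derivWithin R (Icc 0 1) t / R t)) • momentumField R κ t x)
            (ξ (t, x))) := by
  subst hκ
  have hut := isBarenblattProfile_homotheticDensity hu ht
  have hP : Continuous fun x : EuclideanSpace ℝ (Fin d) => momentumField R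
      (SignType.sign (derivWithin R (Icc 0 1) t) * momentumConst u) t x :=
    continuous_const_smul _
  have hξt : Continuous fun x => ξ (t, x) := hξ.continuous.comp (Continuous.prodMk_right t)
  have hdiv : Continuous fun x => spaceDiv ξ t x :=
    (continuous_spaceDiv hξ).comp (Continuous.prodMk_right t)
  have hpressure := hut.integrable_sq_mul (μ := volume.restrict Ω)
    (hdiv.const_mul (-(|derivWithin R (Icc 0 1) t| * √(∫ y, u y * ‖y‖ ^ 2))))
  have hmomentum := hut.integrable_mul (μ := volume.restrict Ω)
    (hP.inner (𝕜 := ℝ) (continuous_materialDeriv_slice (R := R) hξ t))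
  have hscaled : Continuous fun x : EuclideanSpace ℝ (Fin d) =>
      -(d * (derivWithin R (Icc 0 1) t / R t)) •
        momentumField R (SignType.sign (derivWithin R (Icc 0 1) t) * momentumConst u) t x := by
    fun_prop
  have hdrift := hut.integrable_mul (μ := volume.restrict Ω) (hscaled.inner (𝕜 := ℝ) hξt)
  simp only [mul_add (homotheticDensity R u t _)]
  rw [integral_add hpressure hmomentum, integral_add hmomentum hdrift,
    hu.setIntegral_pressure_eq ht hsupp hξ, add_comm]

theorem intervalIntegral_setIntegral_momentum_eq_zero (hu : Continuous u)
    (huc : HasCompactSupport u) (hR : ContDiffOn ℝ 1 R (Icc 0 1))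
    (hRpos : ∀ t ∈ Ioo (0 : ℝ) 1, 0 < R t)
    (hsupp : ∀ t ∈ Ioo (0 : ℝ) 1, Function.support (homotheticDensity R u t) ⊆ Ω)
    (hξ : ContDiff ℝ 1 ξ) (hξc : HasCompactSupport ξ)
    (hξs : tsupport ξ ⊆ Ioo (0 : ℝ) 1 ×ˢ univ) (κ : ℝ) :
    ∫ t in (0 : ℝ)..1, ∫ x in Ω, homotheticDensity R u t x *
      (inner ℝ (momentumField R κ t x) (materialDeriv R ξ (t, x))
        + inner ℝ (-(d * (derivWithin R (Icc 0 1) t / R t)) • momentumField R κ t x)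
          (ξ (t, x))) = 0 := by
  have hR₀ (t : ℝ) (ht : t ∈ Ioo (0 : ℝ) 1) : R t ≠ 0 := (hRpos t ht).ne'
  have hRcont : ContinuousOn R (Ioo 0 1) := hR.continuousOn.mono Ioo_subset_Icc_self
  have hP := continuousOn_momentumField_uncurry (d := d) hRcont hR₀ κ
  have hrate : ContinuousOn (fun t => -(d * (derivWithin R (Icc 0 1) t / R t))) (Ioo 0 1) :=
    (continuousOn_const.mul (((continuousOn_derivWithin_Icc hR).mono Ioo_subset_Icc_self).div
      hRcont hR₀)).neg
  refine intervalIntegral_setIntegral_mul_deriv_along_homothety_eq_zero hu huc hRcont hRpos hsupp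
    (h := fun z => inner ℝ (momentumField R κ z.1 z.2) (ξ z))
    (h' := fun z => inner ℝ (momentumField R κ z.1 z.2) (materialDeriv R ξ z)
      + inner ℝ (-(d * (derivWithin R (Icc 0 1) z.1 / R z.1)) • momentumField R κ z.1 z.2) (ξ z))
    (hξc.image continuous_fst) (image_subset_iff.2 fun z hz => (hξs hz).1) ?_ ?_ ?_
    fun t ht y => (hasDerivAt_momentumField_along_homothety hR ht (hR₀ t ht) κ y).inner ℝ
      (hasDerivAt_along_homothety (hξ.differentiable one_ne_zero) hR ht (hR₀ t ht) y)
  · intro t ht x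
    simp only [image_eq_zero_of_notMem_tsupport fun h => ht ⟨(t, x), h, rfl⟩, inner_zero_right]
  · intro t ht x
    have hx : (t, x) ∉ tsupport ξ := fun h => ht ⟨_, h, rfl⟩
    simp only [image_eq_zero_of_notMem_tsupport hx, materialDeriv_of_notMem_tsupport hx,
      inner_zero_right, add_zero]
  · exact (hP.inner (continuousOn_materialDeriv hR hR₀ hξ)).add
      (((continuousOn_comp_fst hrate).smul hP).inner hξ.continuous.continuousOn)

theorem integrable_momentum_integrand (hu : Continuous u) (hR : ContDiffOn ℝ 1 R (Icc 0 1))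
    (hR₀ : ∀ t ∈ Ioo (0 : ℝ) 1, R t ≠ 0) (hξ : ContDiff ℝ 1 ξ) (hξc : HasCompactSupport ξ)
    (hξs : tsupport ξ ⊆ Ioo (0 : ℝ) 1 ×ˢ univ) (κ m : ℝ) :
    Integrable fun z : ℝ × EuclideanSpace ℝ (Fin d) =>
      homotheticDensity R u z.1 z.2 ^ 2 *
          (-(|derivWithin R (Icc 0 1) z.1| * m) * spaceDiv ξ z.1 z.2)
        + homotheticDensity R u z.1 z.2 *
          inner ℝ (momentumField R κ z.1 z.2) (materialDeriv R ξ z) := by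
  have hRcont : ContinuousOn R (Ioo 0 1) := hR.continuousOn.mono Ioo_subset_Icc_self
  have hut := continuousOn_homotheticDensity_uncurry hu hRcont hR₀
  have hspeed : ContinuousOn (fun t => -(|derivWithin R (Icc 0 1) t| * m)) (Ioo 0 1) :=
    (((continuousOn_derivWithin_Icc hR).mono Ioo_subset_Icc_self).abs.mul continuousOn_const).neg
  refine integrable_of_continuousOn_of_support_subset hξc ?_ fun z hz => ?_
  · exact (((hut.pow 2).mul ((continuousOn_comp_fst hspeed).mul
      (continuous_spaceDiv hξ).continuousOn)).add (hut.mul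
      ((continuousOn_momentumField_uncurry hRcont hR₀ κ).inner
        (continuousOn_materialDeriv hR hR₀ hξ)))).mono hξs
  · by_contra hzξ
    exact hz (by simp only [spaceDiv_eq_zero_of_notMem_tsupport hzξ,
      materialDeriv_of_notMem_tsupport hzξ, inner_zero_right, mul_zero, add_zero])

end Momentum

section WeakSolution

variable {c : ℝ} {R : ℝ → ℝ} {u : EuclideanSpace ℝ (Fin d) → ℝ}
  {Ω : Set (EuclideanSpace ℝ (Fin d))} {σ : SignType}

theorem IsBarenblattProfile.setIntegral_homothetic_momentum_eq_zero
    (hu : IsBarenblattProfile c u) (hR : ContDiffOn ℝ 1 R (Icc 0 1))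
    (hRpos : ∀ t ∈ Ioo (0 : ℝ) 1, 0 < R t)
    (hsupp : ∀ t ∈ Ioo (0 : ℝ) 1, Function.support (homotheticDensity R u t) ⊆ Ω)
    (hσ : ∀ᵐ t ∂(volume.restrict (Ioo (0 : ℝ) 1)), SignType.sign (derivWithin R (Icc 0 1) t) = σ)
    {ξ : ℝ × EuclideanSpace ℝ (Fin d) → EuclideanSpace ℝ (Fin d)} (hξ : ContDiff ℝ 1 ξ)
    (hξc : HasCompactSupport ξ) (hξs : tsupport ξ ⊆ Ioo (0 : ℝ) 1 ×ˢ univ) :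
    ∫ z in Ioo (0 : ℝ) 1 ×ˢ Ω,
      (coeffH Ω 2 2 1 (1 / 2) (homotheticDensity R u) (homotheticField R) z.1
          * homotheticDensity R u z.1 z.2 ^ (2 : ℝ) * spaceDiv ξ z.1 z.2
        + coeffK Ω 2 2 1 (1 / 2) (homotheticDensity R u) (homotheticField R) z.1
          * homotheticDensity R u z.1 z.2 * ‖homotheticField R z.1 z.2‖ ^ (2 - 2 : ℝ) *
          (inner ℝ (homotheticField R z.1 z.2)
            (fderiv ℝ (fun y => ξ (z.1, y)) z.2 (homotheticField R z.1 z.2))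
            + inner ℝ (homotheticField R z.1 z.2) (deriv (fun s => ξ (s, z.2)) z.1))) = 0 := by
  have hIoo := ae_restrict_mem (μ := volume) (measurableSet_Ioo (a := (0 : ℝ)) (b := 1))
  have hint := integrable_momentum_integrand hu.continuous hR (fun t ht => (hRpos t ht).ne')
    hξ hξc hξs (σ * momentumConst u) √(∫ y, u y * ‖y‖ ^ 2)
  refine (setIntegral_prod_eq_intervalIntegral_of_ae_eq zero_le_one hint ?_ ?_).trans
    (intervalIntegral_setIntegral_momentum_eq_zero hu.continuous hu.hasCompactSupport hR hRpos
      hsupp hξ hξc hξs (σ * momentumConst u))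
  · filter_upwards [hσ, hIoo] with t htσ ht x
    rw [← htσ]
    exact momentum_integrand_homothetic_eq hu.nonneg (hRpos t ht) (hsupp t ht)
      (hξ.differentiable one_ne_zero) x
  · filter_upwards [hσ, hIoo] with t htσ ht
    exact hu.setIntegral_momentum_eq (hRpos t ht) (hsupp t ht) hξ (by rw [htσ])

theorem locallyIntegrableOn_pressure_homothetic (hu : Continuous u)
    (hR : ContDiffOn ℝ 1 R (Icc 0 1)) (hRpos : ∀ t ∈ Ioo (0 : ℝ) 1, 0 < R t)
    (hsupp : ∀ t ∈ Ioo (0 : ℝ) 1, Function.support (homotheticDensity R u t) ⊆ Ω)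
    {S : Set (EuclideanSpace ℝ (Fin d))} (hS : MeasurableSet S) :
    LocallyIntegrableOn (fun z : ℝ × EuclideanSpace ℝ (Fin d) =>
      coeffH Ω 2 2 1 (1 / 2) (homotheticDensity R u) (homotheticField R) z.1
        * homotheticDensity R u z.1 z.2 ^ (2 : ℝ)) (Ioo (0 : ℝ) 1 ×ˢ S) := by
  have hRcont : ContinuousOn R (Ioo 0 1) := hR.continuousOn.mono Ioo_subset_Icc_self
  have hspeed : ContinuousOn
      (fun t => -(|derivWithin R (Icc 0 1) t| * √(∫ y, u y * ‖y‖ ^ 2))) (Ioo 0 1) :=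
    (((continuousOn_derivWithin_Icc hR).mono Ioo_subset_Icc_self).abs.mul continuousOn_const).neg
  refine locallyIntegrableOn_prod_of_ae_eq_continuousOn
    (g := fun z => -(|derivWithin R (Icc 0 1) z.1| * √(∫ y, u y * ‖y‖ ^ 2))
      * homotheticDensity R u z.1 z.2 ^ 2) measurableSet_Ioo hS
    ((continuousOn_comp_fst hspeed).mul ((continuousOn_homotheticDensity_uncurry hu hRcont
      fun t ht => (hRpos t ht).ne').pow 2)) ?_
  filter_upwards [ae_restrict_mem measurableSet_Ioo] with t ht x
  simp only [coeffH_homothetic (hRpos t ht) (hsupp t ht), Real.rpow_two]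

theorem locallyIntegrableOn_momentum_homothetic (hu : Continuous u) (hu₀ : 0 ≤ u)
    (hR : ContDiffOn ℝ 1 R (Icc 0 1)) (hRpos : ∀ t ∈ Ioo (0 : ℝ) 1, 0 < R t)
    (hsupp : ∀ t ∈ Ioo (0 : ℝ) 1, Function.support (homotheticDensity R u t) ⊆ Ω)
    (hσ : ∀ᵐ t ∂(volume.restrict (Ioo (0 : ℝ) 1)), SignType.sign (derivWithin R (Icc 0 1) t) = σ)
    {S : Set (EuclideanSpace ℝ (Fin d))} (hS : MeasurableSet S) :
    LocallyIntegrableOn (fun z : ℝ × EuclideanSpace ℝ (Fin d) =>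
      (coeffK Ω 2 2 1 (1 / 2) (homotheticDensity R u) (homotheticField R) z.1
        * homotheticDensity R u z.1 z.2 * ‖homotheticField R z.1 z.2‖ ^ (2 - 2 : ℝ)) •
        homotheticField R z.1 z.2) (Ioo (0 : ℝ) 1 ×ˢ S) := by
  have hRcont : ContinuousOn R (Ioo 0 1) := hR.continuousOn.mono Ioo_subset_Icc_self
  have hR₀ (t : ℝ) (ht : t ∈ Ioo (0 : ℝ) 1) : R t ≠ 0 := (hRpos t ht).ne'
  refine locallyIntegrableOn_prod_of_ae_eq_continuousOn
    (g := fun z => homotheticDensity R u z.1 z.2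
      • momentumField R (σ * momentumConst u) z.1 z.2) measurableSet_Ioo hS
    ((continuousOn_homotheticDensity_uncurry hu hRcont hR₀).smul
      (continuousOn_momentumField_uncurry hRcont hR₀ (σ * momentumConst u))) ?_
  filter_upwards [hσ, ae_restrict_mem measurableSet_Ioo] with t htσ ht x
  simp only [← htσ, ← coeffK_smul_homotheticField hu₀ (hRpos t ht) (hsupp t ht), sub_self,
    Real.rpow_zero, mul_one, smul_smul, mul_comm (homotheticDensity R u t x)]

theorem locallyIntegrableOn_tensor_homothetic (hu : Continuous u) (hu₀ : 0 ≤ u)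
    (hR : ContDiffOn ℝ 1 R (Icc 0 1)) (hRpos : ∀ t ∈ Ioo (0 : ℝ) 1, 0 < R t)
    (hsupp : ∀ t ∈ Ioo (0 : ℝ) 1, Function.support (homotheticDensity R u t) ⊆ Ω)
    (hσ : ∀ᵐ t ∂(volume.restrict (Ioo (0 : ℝ) 1)), SignType.sign (derivWithin R (Icc 0 1) t) = σ)
    {S : Set (EuclideanSpace ℝ (Fin d))} (hS : MeasurableSet S) (i j : Fin d) :
    LocallyIntegrableOn (fun z : ℝ × EuclideanSpace ℝ (Fin d) =>
      coeffK Ω 2 2 1 (1 / 2) (homotheticDensity R u) (homotheticField R) z.1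
        * homotheticDensity R u z.1 z.2 * ‖homotheticField R z.1 z.2‖ ^ (2 - 2 : ℝ) *
        (homotheticField R z.1 z.2 i * homotheticField R z.1 z.2 j)) (Ioo (0 : ℝ) 1 ×ˢ S) := by
  have hRcont : ContinuousOn R (Ioo 0 1) := hR.continuousOn.mono Ioo_subset_Icc_self
  have hR₀ (t : ℝ) (ht : t ∈ Ioo (0 : ℝ) 1) : R t ≠ 0 := (hRpos t ht).ne'
  have hcoord (k : Fin d) : Continuous fun x : EuclideanSpace ℝ (Fin d) => x k := by fun_prop
  refine locallyIntegrableOn_prod_of_ae_eq_continuousOn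
    (g := fun z => homotheticDensity R u z.1 z.2
      * (momentumField R (σ * momentumConst u) z.1 z.2 i * homotheticField R z.1 z.2 j))
    measurableSet_Ioo hS
    ((continuousOn_homotheticDensity_uncurry hu hRcont hR₀).mul
      (((hcoord i).comp_continuousOn
        (continuousOn_momentumField_uncurry hRcont hR₀ (σ * momentumConst u))).mul
        ((hcoord j).comp_continuousOn (continuousOn_homotheticField_uncurry hR hR₀)))) ?_
  filter_upwards [hσ, ae_restrict_mem measurableSet_Ioo] with t htσ ht x
  simp only [← htσ, ← coeffK_smul_homotheticField hu₀ (hRpos t ht) (hsupp t ht), sub_self,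
    Real.rpow_zero, mul_one, PiLp.smul_apply, smul_eq_mul]
  ring

theorem tendsto_setIntegral_mul_homotheticDensity (hu : Measurable u) (hu₀ : 0 ≤ u)
    (hui : Integrable u) {S : Set ℝ} {t : ℝ} (hR : ContinuousWithinAt R S t)
    (hRpos : ∀ s ∈ S, 0 < R s)
    (hsupp : ∀ s ∈ S, Function.support (homotheticDensity R u s) ⊆ Ω)
    (f : BoundedContinuousFunction (EuclideanSpace ℝ (Fin d)) ℝ) :
    Tendsto (fun s => ∫ x in Ω, f x * homotheticDensity R u s x) (𝓝[S] t)
      (𝓝 (∫ x, f x ∂(homotheticCurve R (volume.withDensity fun x => ENNReal.ofReal (u x)) t))) :=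
  have : IsFiniteMeasure (volume.withDensity fun x => ENNReal.ofReal (u x)) :=
    isFiniteMeasure_withDensity_ofReal hui.2
  (tendsto_integral_homotheticCurve hR f).congr' <|
    eventually_nhdsWithin_of_forall fun s hs =>
      (setIntegral_mul_homotheticDensity_eq_integral_homotheticCurve hu hu₀ (hRpos s hs)
        (hsupp s hs) f.continuous).symm

theorem IsBarenblattProfile.integrableOn_norm_homotheticField_sq_mul
    (hu : IsBarenblattProfile c u) {t : ℝ} (ht : 0 < R t) :
    IntegrableOn (fun x => ‖homotheticField R t x‖ ^ 2 * homotheticDensity R u t x) Ω := by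
  have hv : Continuous fun x : EuclideanSpace ℝ (Fin d) => ‖homotheticField R t x‖ ^ 2 :=
    (continuous_homotheticField t).norm.pow 2
  simpa only [IntegrableOn, mul_comm] using
    (isBarenblattProfile_homotheticDensity hu ht).integrable_mul (μ := volume.restrict Ω) hv

theorem IsBarenblattProfile.energyV_homotheticField_pos [Nontrivial (EuclideanSpace ℝ (Fin d))]
    (hu : IsBarenblattProfile c u) (hne : u ≠ 0) {t : ℝ} (ht : 0 < R t)
    (hsupp : Function.support (homotheticDensity R u t) ⊆ Ω)
    (hderiv : derivWithin R (Icc 0 1) t ≠ 0) :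
    0 < energyV Ω 2 (homotheticDensity R u) (homotheticField R) t := by
  have hmoment := integral_mul_norm_sq_pos hu.continuous hu.hasCompactSupport hu.nonneg hne
  rw [energyV_homotheticField ht hsupp]
  positivity

theorem IsBarenblattProfile.isWeakSolution_homothetic [Nontrivial (EuclideanSpace ℝ (Fin d))]
    (hu : IsBarenblattProfile c u) (hmass : ∫ y, u y = 1) (hΩ : MeasurableSet Ω)
    (hR : ContDiffOn ℝ 1 R (Icc 0 1)) (hRpos : ∀ t ∈ Ioo (0 : ℝ) 1, 0 < R t)
    (hsupp : ∀ t ∈ Ioo (0 : ℝ) 1, Function.support (homotheticDensity R u t) ⊆ Ω)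
    (hderiv : ∀ᵐ t ∂(volume.restrict (Ioo (0 : ℝ) 1)), derivWithin R (Icc 0 1) t ≠ 0)
    (hσ : ∀ᵐ t ∂(volume.restrict (Ioo (0 : ℝ) 1)), SignType.sign (derivWithin R (Icc 0 1) t) = σ) :
    IsWeakSolution Ω 2 2 1 (1 / 2)
      (homotheticCurve R (volume.withDensity fun x => ENNReal.ofReal (u x)) 0)
      (homotheticCurve R (volume.withDensity fun x => ENNReal.ofReal (u x)) 1)
      (homotheticDensity R u) (homotheticField R) := by
  have hIoo := ae_restrict_mem (μ := volume) (measurableSet_Ioo (a := (0 : ℝ)) (b := 1))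
  have hR₀ (t : ℝ) (ht : t ∈ Ioo (0 : ℝ) 1) : R t ≠ 0 := (hRpos t ht).ne'
  have hut := continuousOn_homotheticDensity_uncurry hu.continuous
    (hR.continuousOn.mono Ioo_subset_Icc_self) hR₀
  have hut' (t : ℝ) (ht : t ∈ Ioo (0 : ℝ) 1) :=
    isBarenblattProfile_homotheticDensity hu (hRpos t ht)
  have hne : u ≠ 0 := fun h => by simp [h] at hmass
  have hlim (t : ℝ) (ht : t ∈ Icc (0 : ℝ) 1) :=
    tendsto_setIntegral_mul_homotheticDensity hu.continuous.measurable hu.nonneg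
      (hu.continuous.integrable_of_hasCompactSupport hu.hasCompactSupport)
      ((hR.continuousOn t ht).mono Ioo_subset_Icc_self) hRpos hsupp
  exact
  { nonneg t ht := (hut' t ht).nonneg
    mass t ht := by
      simpa only [mul_one, hmass] using
        setIntegral_homotheticDensity_mul (hsupp t ht) (hRpos t ht) fun _ => 1
    finite_F := hIoo.mono fun t ht => by
      simpa only [IntegrableOn, Real.rpow_two, mul_one] using
        (hut' t ht).integrable_sq_mul (μ := volume.restrict Ω) (continuous_const (y := 1))
    finite_V := hIoo.mono fun t ht => by
      simpa only [Real.rpow_two] using hu.integrableOn_norm_homotheticField_sq_mul (hRpos t ht)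
    pos_V _ := (hIoo.and hderiv).mono fun t ht =>
      hu.energyV_homotheticField_pos hne (hRpos t ht.1) (hsupp t ht.1) ht.2
    locInt_pressure := locallyIntegrableOn_pressure_homothetic hu.continuous hR hRpos hsupp
      isOpen_interior.measurableSet
    locInt_tensor := locallyIntegrableOn_tensor_homothetic hu.continuous hu.nonneg hR hRpos
      hsupp hσ isOpen_interior.measurableSet
    locInt_momentum := locallyIntegrableOn_momentum_homothetic hu.continuous hu.nonneg hR hRpos
      hsupp hσ isOpen_interior.measurableSet
    locInt_density := locallyIntegrableOn_prod_of_ae_eq_continuousOn measurableSet_Ioo hΩ hut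
      (ae_of_all _ fun _ _ => rfl)
    locInt_flux := locallyIntegrableOn_prod_of_ae_eq_continuousOn measurableSet_Ioo hΩ
      (hut.smul (continuousOn_homotheticField_uncurry hR hR₀)) (ae_of_all _ fun _ _ => rfl)
    momentum ξ hξ hξc hξs := hu.setIntegral_homothetic_momentum_eq_zero hR hRpos hsupp hσ
      (hξ.of_le (by simp)) hξc (hξs.trans (prod_mono_right (subset_univ _)))
    continuity φ hφ hφc hφs := setIntegral_homothetic_continuity_eq_zero hu.continuous
      hu.hasCompactSupport hR hRpos hsupp (hφ.of_le (by simp)) hφc hφs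
    initial f := by
      simpa only [nhdsWithin_Ioo_eq_nhdsGT zero_lt_one] using hlim 0 (by simp) f
    final f := by
      simpa only [nhdsWithin_Ioo_eq_nhdsLT zero_lt_one] using hlim 1 (by simp) f }

end WeakSolution

section ParabolicDensity

variable {A ρ : ℝ}

theorem pos_of_isProbabilityMeasure_parabolicDensity
    (h : IsProbabilityMeasure ((volume : Measure (EuclideanSpace ℝ (Fin d))).withDensity
      fun x => ENNReal.ofReal (parabolicDensity A ρ x))) : 0 < A := by
  by_contra! hA
  have hzero (x : EuclideanSpace ℝ (Fin d)) : ENNReal.ofReal (parabolicDensity A ρ x) = 0 :=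
    ENNReal.ofReal_of_nonpos (mul_nonpos_of_nonpos_of_nonneg hA (le_max_right _ _))
  simp [isProbabilityMeasure_iff, hzero] at h

theorem ae_norm_le_withDensity_parabolicDensity (hρ : 0 ≤ ρ) :
    ∀ᵐ y ∂((volume : Measure (EuclideanSpace ℝ (Fin d))).withDensity
      fun x => ENNReal.ofReal (parabolicDensity A ρ x)), ‖y‖ ≤ ρ := by
  rw [ae_withDensity_iff (continuous_parabolicDensity A ρ).measurable.ennreal_ofReal]
  refine ae_of_all _ fun x hx => ?_
  contrapose! hx
  rw [parabolicDensity_eq_zero_of_le_norm hρ A hx.le, ENNReal.ofReal_zero]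

theorem starConvex_zero_of_withDensity_parabolicDensity_compl_eq_zero (hρ : ρ ≠ 0)
    (hprob : IsProbabilityMeasure ((volume : Measure (EuclideanSpace ℝ (Fin d))).withDensity
      fun x => ENNReal.ofReal (parabolicDensity A ρ x)))
    {Ω : Set (EuclideanSpace ℝ (Fin d))} (hΩclosed : IsClosed Ω) (hΩconvex : Convex ℝ Ω)
    (h : volume.withDensity (fun x => ENNReal.ofReal (parabolicDensity A ρ x)) Ωᶜ = 0) :
    StarConvex ℝ 0 Ω :=
  have hA : 0 < A := pos_of_isProbabilityMeasure_parabolicDensity hprob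
  hΩconvex.starConvex <| support_subset_of_withDensity_compl_eq_zero
    (continuous_parabolicDensity A ρ) (fun _ => mul_nonneg hA.le (le_max_right _ _)) hΩclosed h
    (parabolicDensity_zero_pos hA hρ).ne'

end ParabolicDensity

theorem integral_eq_one_of_isProbabilityMeasure_withDensity {α : Type*} [MeasurableSpace α]
    {μ : Measure α} {u : α → ℝ} (hu : Measurable u) (hu₀ : 0 ≤ u)
    (hprob : IsProbabilityMeasure (μ.withDensity fun x => ENNReal.ofReal (u x))) :
    ∫ x, u x ∂μ = 1 := by
  simpa using (integral_withDensity_ofReal (μ := μ) hu hu₀ fun _ => 1).symm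

end WeightedWasserstein

open WeightedWasserstein in
theorem mainTheorem5_general {d : ℕ} (hd : 1 ≤ d)
    (Ω : Set (EuclideanSpace ℝ (Fin d))) (hΩclosed : IsClosed Ω)
    (A ρ : ℝ) (hρ : 0 < ρ)
    (μbar : Measure (EuclideanSpace ℝ (Fin d))) (hμprob : IsProbabilityMeasure μbar)
    (hμdens : μbar = volume.withDensity (fun x => ENNReal.ofReal (parabolicDensity A ρ x)))
    (R : ℝ → ℝ) (hRreg : ContDiffOn ℝ 1 R (Icc 0 1))
    (hRmaps : MapsTo R (Icc 0 1) (Ici 0))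
    (hRmono : MonotoneOn R (Icc 0 1) ∨ AntitoneOn R (Icc 0 1))
    (hRderiv : ∀ᵐ t ∂(volume.restrict (Icc (0 : ℝ) 1)), derivWithin R (Icc 0 1) t ≠ 0)
    (hΩ : ∀ t ∈ Icc (0 : ℝ) 1, homotheticCurve R μbar t Ωᶜ = 0) :
    IsLipschitzCurve Ω 2 (homotheticCurve R μbar) ∧
    IsTangentField Ω 2 (homotheticCurve R μbar) (homotheticField R) ∧
    (∀ t ∈ Ioo (0 : ℝ) 1, homotheticCurve R μbar t = volume.withDensity
      (fun x => ENNReal.ofReal (homotheticDensity R (parabolicDensity A ρ) t x))) ∧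
    IsWeakSolution Ω 2 2 1 (1 / 2) (homotheticCurve R μbar 0) (homotheticCurve R μbar 1)
      (homotheticDensity R (parabolicDensity A ρ)) (homotheticField R) ∧
    NoFlux Ω (homotheticDensity R (parabolicDensity A ρ)) (homotheticField R) := by
  subst hμdens
  have : Nontrivial (EuclideanSpace ℝ (Fin d)) :=
    Module.nontrivial_of_finrank_pos (R := ℝ) (by rw [finrank_euclideanSpace_fin]; exact hd)
  have hu := isBarenblattProfile_parabolicDensity (d := d)
    (pos_of_isProbabilityMeasure_parabolicDensity hμprob).le hρ.le
  have hmass := integral_eq_one_of_isProbabilityMeasure_withDensity hu.continuous.measurable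
    hu.nonneg hμprob
  have hbound := ae_norm_le_withDensity_parabolicDensity (d := d) (A := A) hρ.le
  have hRpos (t : ℝ) (ht : t ∈ Ioo (0 : ℝ) 1) : 0 < R t :=
    pos_of_monotoneOn_or_antitoneOn hRmaps hRmono hRderiv ht
  have hsupp (t : ℝ) (ht : t ∈ Ioo (0 : ℝ) 1) :=
    support_homotheticDensity_subset hu.continuous hu.nonneg hΩclosed (hRpos t ht)
      (hΩ t (Ioo_subset_Icc_self ht))
  obtain ⟨L, hL⟩ := hRreg.exists_lipschitzOnWith one_ne_zero (convex_Icc 0 1) isCompact_Icc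
  obtain ⟨σ, hσ⟩ := exists_ae_sign_derivWithin_eq hRmono hRderiv
  exact ⟨isLipschitzCurve_homotheticCurve one_le_two hL
      (.of_bound aestronglyMeasurable_id ρ hbound) hΩ,
    isTangentField_homotheticField Ω hρ.le hbound hRreg fun t ht => (hRpos t ht).ne',
    fun t ht => homotheticCurve_withDensity hu.continuous.measurable (hRpos t ht),
    hu.isWeakSolution_homothetic hmass hΩclosed.measurableSet hRreg hRpos hsupp
      (ae_restrict_of_ae_restrict_of_subset Ioo_subset_Icc_self hRderiv)
      (ae_restrict_of_ae_restrict_of_subset Ioo_subset_Icc_self hσ),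
    noFlux_of_support_subset (fun t _ => continuous_homotheticDensity hu.continuous t) hsupp _⟩

theorem mainTheorem5 {d : ℕ} (hd : 1 ≤ d)
    (Ω : Set (EuclideanSpace ℝ (Fin d))) (hΩclosed : IsClosed Ω) (hΩconvex : Convex ℝ Ω)
    (A ρ : ℝ) (hρ : 0 < ρ)
    (μbar : Measure (EuclideanSpace ℝ (Fin d)))
    (hμprob : IsProbabilityMeasure μbar) (hμΩ : μbar Ωᶜ = 0)
    (hμdens : μbar = volume.withDensity
      (fun x => ENNReal.ofReal (WeightedWasserstein.parabolicDensity A ρ x)))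
    (R : ℝ → ℝ) (hRreg : ContDiffOn ℝ 1 R (Icc 0 1))
    (hRmaps : MapsTo R (Icc 0 1) (Icc 0 1))
    (hRmono : MonotoneOn R (Icc 0 1) ∨ AntitoneOn R (Icc 0 1))
    (hRderiv : ∀ᵐ t ∂(volume.restrict (Icc (0 : ℝ) 1)), derivWithin R (Icc 0 1) t ≠ 0) :
    WeightedWasserstein.IsLipschitzCurve Ω 2 (WeightedWasserstein.homotheticCurve R μbar) ∧
    WeightedWasserstein.IsTangentField Ω 2 (WeightedWasserstein.homotheticCurve R μbar)
      (WeightedWasserstein.homotheticField R) ∧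
    (∀ t ∈ Ioo (0 : ℝ) 1, WeightedWasserstein.homotheticCurve R μbar t =
      volume.withDensity (fun x => ENNReal.ofReal (WeightedWasserstein.homotheticDensity R
        (WeightedWasserstein.parabolicDensity A ρ) t x))) ∧
    WeightedWasserstein.IsWeakSolution Ω 2 2 1 (1 / 2)
      (WeightedWasserstein.homotheticCurve R μbar 0)
      (WeightedWasserstein.homotheticCurve R μbar 1)
      (WeightedWasserstein.homotheticDensity R (WeightedWasserstein.parabolicDensity A ρ))
      (WeightedWasserstein.homotheticField R) ∧
    WeightedWasserstein.NoFlux Ω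
      (WeightedWasserstein.homotheticDensity R (WeightedWasserstein.parabolicDensity A ρ))
      (WeightedWasserstein.homotheticField R) := by
  subst hμdens
  exact mainTheorem5_general hd Ω hΩclosed A ρ hρ _ hμprob rfl R hRreg (fun _ ht => (hRmaps ht).1)
    hRmono hRderiv fun _ ht =>
      WeightedWasserstein.homotheticCurve_compl_eq_zero_of_starConvex hΩclosed.measurableSet
        (WeightedWasserstein.starConvex_zero_of_withDensity_parabolicDensity_compl_eq_zero hρ.ne'
          hμprob hΩclosed hΩconvex hμΩ) hμΩ (hRmaps ht)
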